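/- All posets are partially ordered sets, and formulas are those of intuitionistic propositional logic $\mathsf{IPC}$. For a set $\Gamma$ of formulas, $\mathsf{IPC}\oplus\Gamma$ is the least set of formulas that contains $\mathsf{IPC}$ and $\Gamma$ and is closed under modus ponens and uniform substitution. For a finite poset $Q$ with least element (root) $r$, take distinct variables $p_U$, one for each upset $U$ of $Q$. Its *Yankov formula* $\mathcal J(Q)$ is $\delta_Q\to p_{Q\setminus\{r\}}$, where $\delta_Q$ is the conjunction of $p_\emptyset\leftrightarrow\bot$ and of all the formulas $p_{U\cap W}\leftrightarrow p_U\wedge p_W$, $p_{U\cup W}\leftrightarrow p_U\vee p_W$ and $p_{U\Rightarrow W}\leftrightarrow(p_U\to p_W)$, with $U\Rightarrow W=\{x:\forall y\ge x\,(y\in U\Rightarrow y\in W)\}$. Consider the following finite posets with root $r$ (with the relations generated by those listed): - $Q_2$: $r<a,b$; $a<c,d$; $b<d$. - $Q_4$: $r<a,b$; $a<c,d$; $b<c,d$. - $Q_5$: $Q_4$ with a new greatest element. - $Q_6$: $r<a,b<c$, with $a,b$ incomparable. - $Q_7$: $r<a,b$; $a<c$; $b<d$. - $Q_8$: $r<a,b,c$,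 with $a,b,c$ pairwise incomparable. For $n\ge1$ the *$n$-comb* is the poset on $2n$ distinct points $x_1,\dots,x_n,y_1,\dots,y_n$ in which $x_i\le x_j$ iff $i\le j$, $x_i\le y_j$ iff $i\le j$, and nothing is above $y_i$ except $y_i$ itself. A *broken comb* is a poset isomorphic to a subposet of an $n$-comb, for some $n\ge1$, that contains all of $x_1,\dots,x_n$. Let $\mathsf{LFC}$ be the set of formulas that are valid, in the Kripke semantics, in every $n$-comb, $n\ge1$. A poset is a *frame* for a logic $L$ if all formulas of $L$ are valid in it. **Theorem.** Let $L=\mathsf{IPC}\oplus\{\mathcal J(Q_i): i\in\{2,4,5,6,7,8\}\}$. Then: 1. $L$ is locally tabular: for every finite set of variables there are, up to $L$-provable equivalence, only finitely many formulas in these variables. Also, the class of Heyting algebras that validate $L$ is locally finite: in each of them every finitely generated Heyting subalgebra is finite. 2. The finite rooted posets that are frames for $L$ are exactly the broken combs. 3. $L=\mathsf{LFC}$. -/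

import Mathlib

universe u v

namespace CombLogic

/-! ### Formulas and superintuitionistic logics -/

/-- Intuitionistic propositional formulas over the variables `p₀, p₁, p₂, …`. -/
inductive Form : Type
  | var : ℕ → Form
  | bot : Form
  | and : Form → Form → Form
  | or : Form → Form → Form
  | imp : Form → Form → Form

namespace Form

/-- `φ ↔ ψ` abbreviates `(φ → ψ) ∧ (ψ → φ)`. -/
def iff (φ ψ : Form) : Form := and (imp φ ψ) (imp ψ φ)

/-- `⊤` abbreviates `⊥ → ⊥`. -/
def top : Form := imp bot bot

/-- The conjunction of a finite list of formulas. -/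
def conj : List Form → Form
  | [] => top
  | φ :: l => and φ (conj l)

/-- Uniform substitution. -/
def subst (σ : ℕ → Form) : Form → Form
  | var n => σ n
  | bot => bot
  | and φ ψ => and (subst σ φ) (subst σ ψ)
  | or φ ψ => or (subst σ φ) (subst σ ψ)
  | imp φ ψ => imp (subst σ φ) (subst σ ψ)

/-- The set of variables that occur in a formula. -/
def vars : Form → Set ℕ
  | var n => {n}
  | bot => ∅
  | and φ ψ => vars φ ∪ vars ψ
  | or φ ψ => vars φ ∪ vars ψ
  | imp φ ψ => vars φ ∪ vars ψ

/-- The value of a formula in a Heyting algebra. -/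
def eval {H : Type u} [HeytingAlgebra H] (a : ℕ → H) : Form → H
  | var n => a n
  | bot => ⊥
  | and φ ψ => eval a φ ⊓ eval a ψ
  | or φ ψ => eval a φ ⊔ eval a ψ
  | imp φ ψ => eval a φ ⇨ eval a ψ

/-- Kripke forcing: `Forces V x φ` says that `φ` holds at the point `x` of the poset `P`, where
`V n` is the set of points at which the variable `pₙ` holds. -/
def Forces {P : Type u} [PartialOrder P] (V : ℕ → Set P) : P → Form → Prop
  | x, var n => x ∈ V n
  | _, bot => False
  | x, and φ ψ => Forces V x φ ∧ Forces V x ψ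
  | x, or φ ψ => Forces V x φ ∨ Forces V x ψ
  | x, imp φ ψ => ∀ y, x ≤ y → Forces V y φ → Forces V y ψ

end Form

open Form

/-- `Provable Γ φ`: the formula `φ` belongs to `IPC ⊕ Γ`, i.e. it is derivable from the axioms of
intuitionistic propositional logic and the formulas in `Γ` by modus ponens and uniform
substitution. -/
inductive Provable (Γ : Set Form) : Form → Prop
  | ax {φ} : φ ∈ Γ → Provable Γ φ
  | k (φ ψ) : Provable Γ (imp φ (imp ψ φ))
  | s (φ ψ χ) : Provable Γ (imp (imp φ (imp ψ χ)) (imp (imp φ ψ) (imp φ χ)))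
  | andLeft (φ ψ) : Provable Γ (imp (and φ ψ) φ)
  | andRight (φ ψ) : Provable Γ (imp (and φ ψ) ψ)
  | andIntro (φ ψ) : Provable Γ (imp φ (imp ψ (and φ ψ)))
  | orLeft (φ ψ) : Provable Γ (imp φ (or φ ψ))
  | orRight (φ ψ) : Provable Γ (imp ψ (or φ ψ))
  | orElim (φ ψ χ) : Provable Γ (imp (imp φ χ) (imp (imp ψ χ) (imp (or φ ψ) χ)))
  | exFalso (φ) : Provable Γ (imp bot φ)
  | mp {φ ψ} : Provable Γ (imp φ ψ) → Provable Γ φ → Provable Γ ψ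
  | subst {φ} (σ : ℕ → Form) : Provable Γ φ → Provable Γ (Form.subst σ φ)

/-- The logic `IPC ⊕ Γ`, as a set of formulas. -/
def IPCPlus (Γ : Set Form) : Set Form := {φ | Provable Γ φ}

/-- A logic `L` is locally tabular if for every finite set `s` of variables there are only finitely
many formulas over `s` up to `L`-provable equivalence. -/
def LocallyTabular (L : Set Form) : Prop :=
  ∀ s : Finset ℕ, ∃ F : Set Form, F.Finite ∧ (∀ ψ ∈ F, ψ.vars ⊆ s) ∧
    ∀ φ : Form, φ.vars ⊆ s → ∃ ψ ∈ F, Form.iff φ ψ ∈ L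

/-! ### Algebraic semantics -/

/-- `H ∈ Alg(L)`: the Heyting algebra `H` validates every formula of `L`. -/
def IsAlgebraFor (H : Type u) [HeytingAlgebra H] (L : Set Form) : Prop :=
  ∀ φ ∈ L, ∀ a : ℕ → H, φ.eval a = ⊤

/-- The Heyting subalgebra of `H` generated by `S`. -/
inductive Generated {H : Type u} [HeytingAlgebra H] (S : Set H) : H → Prop
  | basic {a} : a ∈ S → Generated S a
  | bot : Generated S ⊥
  | inf {a b} : Generated S a → Generated S b → Generated S (a ⊓ b)
  | sup {a b} : Generated S a → Generated S b → Generated S (a ⊔ b)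
  | himp {a b} : Generated S a → Generated S b → Generated S (a ⇨ b)

/-- A Heyting algebra is locally finite if its finitely generated subalgebras are finite. -/
def LocallyFiniteAlgebra (H : Type u) [HeytingAlgebra H] : Prop :=
  ∀ S : Set H, S.Finite → {a | Generated S a}.Finite

/-! ### Kripke semantics -/

/-- `P ⊩ φ`: the formula `φ` holds at all points of `P` under all upset-valued valuations. -/
def Validates (P : Type u) [PartialOrder P] (φ : Form) : Prop :=
  ∀ V : ℕ → Set P, (∀ n, IsUpperSet (V n)) → ∀ x : P, Forces V x φ

/-- `P` is a frame for the logic `L`. -/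
def IsFrameFor (P : Type u) [PartialOrder P] (L : Set Form) : Prop :=
  ∀ φ ∈ L, Validates P φ

/-- A poset is rooted if it has a least element. -/
def IsRooted (P : Type u) [PartialOrder P] : Prop := ∃ r : P, ∀ x, r ≤ x

/-! ### Yankov formulas -/

/-- The upsets of a poset. -/
abbrev Up (Q : Type u) [PartialOrder Q] : Type u := {U : Set Q // IsUpperSet U}

namespace Up

variable {Q : Type u} [PartialOrder Q]

/-- The least element of the Heyting algebra of upsets. -/
def empty : Up Q := ⟨∅, isUpperSet_empty⟩

/-- Meets in the Heyting algebra of upsets. -/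
def inter (U W : Up Q) : Up Q := ⟨U.1 ∩ W.1, U.2.inter W.2⟩

/-- Joins in the Heyting algebra of upsets. -/
def union (U W : Up Q) : Up Q := ⟨U.1 ∪ W.1, U.2.union W.2⟩

/-- Implication in the Heyting algebra of upsets. -/
def himp (U W : Up Q) : Up Q :=
  ⟨{x | ∀ y, x ≤ y → y ∈ U.1 → y ∈ W.1}, fun _ _ hab ha y hy => ha y (hab.trans hy)⟩

/-- The upset of all points that are not below `r`. If `r` is the root of `Q`, this is `Q ∖ {r}`,
the second greatest element of the Heyting algebra of upsets. -/
def notBelow (r : Q) : Up Q := ⟨{x | ¬ x ≤ r}, fun _ _ hab ha hb => ha (hab.trans hb)⟩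

end Up

noncomputable section

/-- For a finite poset `Q`, distinct propositional variables `p_U`, one for each upset `U` of `Q`. -/
def upVar {Q : Type u} [PartialOrder Q] [Finite Q] (U : Up Q) : Form :=
  var (Finite.equivFin (Up Q) U : ℕ)

/-- The diagram of the finite Heyting algebra of upsets of `Q`: the conjunction of
`p_∅ ↔ ⊥` and, over all upsets `U`, `W`, of `p_{U ∩ W} ↔ p_U ∧ p_W`, `p_{U ∪ W} ↔ p_U ∨ p_W`
and `p_{U ⇒ W} ↔ (p_U → p_W)`. -/
def diagram (Q : Type u) [PartialOrder Q] [Finite Q] : Form :=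
  letI : Fintype (Up Q × Up Q) := Fintype.ofFinite _
  Form.and (Form.iff (upVar (Up.empty : Up Q)) bot)
    (conj ((Finset.univ : Finset (Up Q × Up Q)).toList.map fun x =>
      Form.and (Form.iff (upVar (x.1.inter x.2)) (Form.and (upVar x.1) (upVar x.2)))
        (Form.and (Form.iff (upVar (x.1.union x.2)) (Form.or (upVar x.1) (upVar x.2)))
          (Form.iff (upVar (x.1.himp x.2)) (Form.imp (upVar x.1) (upVar x.2))))))

/-- The Yankov formula of the finite poset `Q` with root `r`. -/
def yankov (Q : Type u) [PartialOrder Q] [Finite Q] (r : Q) : Form :=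
  Form.imp (diagram Q) (upVar (Up.notBelow r))

end

/-! ### The posets `Q₂, Q₄, Q₅, Q₆, Q₇, Q₈`

In each of them `0` is the root. -/

/-- Root `0`; `1` and `2` cover `0`; `3` and `4` are maximal; `1 < 3, 4` and `2 < 4`. -/
def Q2 : Type := Fin 5

/-- Root `0`; `1` and `2` cover `0`; `3` and `4` are maximal; `1 < 3, 4` and `2 < 3, 4`. -/
def Q4 : Type := Fin 5

/-- The poset `Q4` with a new greatest element `5`. -/
def Q5 : Type := Fin 6

/-- The diamond: `0 < 1, 2 < 3`. -/
def Q6 : Type := Fin 4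

/-- Root `0`; above it the two disjoint chains `1 < 3` and `2 < 4`. -/
def Q7 : Type := Fin 5

/-- The three-fork: root `0` and three maximal points `1`, `2`, `3`. -/
def Q8 : Type := Fin 4

instance : Finite Q2 := inferInstanceAs (Finite (Fin 5))
instance : Finite Q4 := inferInstanceAs (Finite (Fin 5))
instance : Finite Q5 := inferInstanceAs (Finite (Fin 6))
instance : Finite Q6 := inferInstanceAs (Finite (Fin 4))
instance : Finite Q7 := inferInstanceAs (Finite (Fin 5))
instance : Finite Q8 := inferInstanceAs (Finite (Fin 4))

instance : PartialOrder Q2 where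
  le (i j : Fin 5) := i = j ∨ i = 0 ∨ (i = 1 ∧ (j = 3 ∨ j = 4)) ∨ (i = 2 ∧ j = 4)
  le_refl _ := Or.inl rfl
  le_trans := by unfold Q2; decide
  le_antisymm := by unfold Q2; decide

instance : PartialOrder Q4 where
  le (i j : Fin 5) := i = j ∨ i = 0 ∨ ((i = 1 ∨ i = 2) ∧ (j = 3 ∨ j = 4))
  le_refl _ := Or.inl rfl
  le_trans := by unfold Q4; decide
  le_antisymm := by unfold Q4; decide

instance : PartialOrder Q5 where
  le (i j : Fin 6) := i = j ∨ i = 0 ∨ j = 5 ∨ ((i = 1 ∨ i = 2) ∧ (j = 3 ∨ j = 4))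
  le_refl _ := Or.inl rfl
  le_trans := by unfold Q5; decide
  le_antisymm := by unfold Q5; decide

instance : PartialOrder Q6 where
  le (i j : Fin 4) := i = j ∨ i = 0 ∨ j = 3
  le_refl _ := Or.inl rfl
  le_trans := by unfold Q6; decide
  le_antisymm := by unfold Q6; decide

instance : PartialOrder Q7 where
  le (i j : Fin 5) := i = j ∨ i = 0 ∨ (i = 1 ∧ j = 3) ∨ (i = 2 ∧ j = 4)
  le_refl _ := Or.inl rfl
  le_trans := by unfold Q7; decide
  le_antisymm := by unfold Q7; decide

instance : PartialOrder Q8 where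
  le (i j : Fin 4) := i = j ∨ i = 0
  le_refl _ := Or.inl rfl
  le_trans := by unfold Q8; decide
  le_antisymm := by unfold Q8; decide

/-- The Yankov formulas of `Q₂, Q₄, Q₅, Q₆, Q₇, Q₈`. -/
noncomputable def combAxioms : Set Form :=
  {yankov Q2 (0 : Fin 5), yankov Q4 (0 : Fin 5), yankov Q5 (0 : Fin 6),
    yankov Q6 (0 : Fin 4), yankov Q7 (0 : Fin 5), yankov Q8 (0 : Fin 4)}

/-! ### Combs -/

/-- The `n`-comb, with points `x₁, …, xₙ` (`base`) and `y₁, …, yₙ` (`tooth`). -/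
inductive Comb (n : ℕ) : Type
  | base : Fin n → Comb n
  | tooth : Fin n → Comb n

/-- The order of the `n`-comb: `xᵢ ≤ xⱼ` iff `i ≤ j`, `xᵢ ≤ yⱼ` iff `i ≤ j`, and `yᵢ` is below
itself only. -/
def Comb.le {n : ℕ} : Comb n → Comb n → Prop
  | .base i, .base j => i ≤ j
  | .base i, .tooth j => i ≤ j
  | .tooth _, .base _ => False
  | .tooth i, .tooth j => i = j

instance (n : ℕ) : PartialOrder (Comb n) where
  le := Comb.le
  le_refl x := by cases x <;> simp [Comb.le]
  le_trans x y z := by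
    cases x <;> cases y <;> cases z <;> simp only [Comb.le] <;> intro h₁ h₂ <;>
      first | exact h₁.elim | exact h₂.elim | exact h₁.trans h₂ | exact h₂ ▸ h₁
  le_antisymm x y := by
    cases x <;> cases y <;> simp only [Comb.le] <;> intro h₁ h₂ <;>
      first
        | exact h₁.elim
        | exact h₂.elim
        | exact congrArg _ h₁
        | exact congrArg _ (le_antisymm h₁ h₂)

/-- `P` is a broken comb: up to isomorphism, it is a subposet of an `n`-comb, for some `n ≥ 1`,
that contains all the points `x₁, …, xₙ`. -/
def IsBrokenComb (P : Type u) [PartialOrder P] : Prop :=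
  ∃ n : ℕ, 0 < n ∧ ∃ e : P ↪o Comb n, ∀ i : Fin n, Comb.base i ∈ Set.range e

/-- The logic of finite combs: the formulas valid in all `n`-combs, `n ≥ 1`. -/
def LFC : Set Form := {φ | ∀ n : ℕ, 0 < n → Validates (Comb n) φ}

end CombLogic

namespace CombLogic

open Form

/-! ### Kripke semantics -/

section Kripke

variable {P : Type u} {Q : Type v} [PartialOrder P] [PartialOrder Q]

/-! Of the six axioms, only the diamond `Q6` and the three-fork `Q8` restrict algebras and frames in
this argument; the other four merely have to be valid in combs.

The diamond forces the non-maximal points above any point to form a chain. If `x` and `y` are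
non-maximal and incomparable, let `A` and `B` consist of the points above `x`, respectively `y`,
together with all maximal points. Recording at each point which of `A ⊆ B` and `B ⊆ A` holds above
it is a p-morphism onto the diamond (`diamondMap_isPMorphismAbove`). For prime filters of a Heyting
algebra the map must be definable, so dense elements take over the role of the set of maximal points
(`le_or_le_of_not_total`).

Local finiteness needs only this chain property. Given finitely many generators, assign to a prime
filter the set of local types occurring above it. By the chain property, equality of these sets is a
bisimulation of finite index (`exists_upType_eq`), and generated elements are unions of its classes.
The Lindenbaum algebra turns this into local tabularity.

In a finite rooted frame the chain, prolonged by one maximal point, is the base of a comb, and the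
three-fork leaves room for at most one further maximal point at each level
(`isBrokenComb_of_validates`). Conversely, collapsing missing teeth makes a broken comb a p-morphic
image of a comb (`IsBrokenComb.validates`).

For completeness, a formula lives in a finite subalgebra of the Lindenbaum algebra. The cones of its
prime filter space are broken combs, so formulas of `LFC` take the value `⊤` there
(`eval_eq_top_of_mem_LFC`). -/

theorem Forces.mono {V : ℕ → Set P} (hV : ∀ n, IsUpperSet (V n)) (φ : Form) :
    ∀ {x y : P}, x ≤ y → Forces V x φ → Forces V y φ := by
  induction φ with
  | var n => exact fun h hx => hV n h hx
  | bot => exact fun _ hx => hx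
  | and φ ψ ih₁ ih₂ => exact fun h hx => ⟨ih₁ h hx.1, ih₂ h hx.2⟩
  | or φ ψ ih₁ ih₂ => exact fun h hx => hx.imp (ih₁ h) (ih₂ h)
  | imp φ ψ _ _ => exact fun h hx z hz => hx z (h.trans hz)

theorem forces_subst {V : ℕ → Set P} (σ : ℕ → Form) (φ : Form) :
    ∀ x : P, Forces V x (φ.subst σ) ↔ Forces (fun n => {y | Forces V y (σ n)}) x φ := by
  induction φ with
  | var n => exact fun x => Iff.rfl
  | bot => exact fun x => Iff.rfl
  | and φ ψ ih₁ ih₂ => exact fun x => and_congr (ih₁ x) (ih₂ x)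
  | or φ ψ ih₁ ih₂ => exact fun x => or_congr (ih₁ x) (ih₂ x)
  | imp φ ψ ih₁ ih₂ =>
    exact fun x => forall_congr' fun y => imp_congr_right fun _ => imp_congr (ih₁ y) (ih₂ y)

theorem Provable.validates {Γ : Set Form} (hΓ : ∀ φ ∈ Γ, Validates P φ) {φ : Form}
    (h : Provable Γ φ) : Validates P φ := by
  induction h with
  | ax h => exact hΓ _ h
  | k φ ψ => exact fun V hV x y _ h z hz _ => Forces.mono hV φ hz h
  | s φ ψ χ =>
    exact fun V hV x y _ h z hz h' w hw hφ => h w (hz.trans hw) hφ w le_rfl (h' w hw hφ)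
  | andLeft φ ψ => exact fun V hV x y _ h => h.1
  | andRight φ ψ => exact fun V hV x y _ h => h.2
  | andIntro φ ψ => exact fun V hV x y _ h z hz h' => ⟨Forces.mono hV φ hz h, h'⟩
  | orLeft φ ψ => exact fun V hV x y _ h => Or.inl h
  | orRight φ ψ => exact fun V hV x y _ h => Or.inr h
  | orElim φ ψ χ =>
    exact fun V hV x y _ h z hz h' w hw h'' => h''.elim (h w (hz.trans hw)) (h' w hw)
  | exFalso φ => exact fun V hV x y _ h => h.elim
  | mp _ _ ih₁ ih₂ => exact fun V hV x => ih₁ V hV x x le_rfl (ih₂ V hV x)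
  | subst σ _ ih =>
    exact fun V hV x => (forces_subst σ _ x).2
      (ih _ (fun n _ _ hab ha => Forces.mono hV (σ n) hab ha) x)

theorem forces_iff {V : ℕ → Set P} {x : P} {φ ψ : Form} :
    Forces V x (Form.iff φ ψ) ↔ ∀ y, x ≤ y → (Forces V y φ ↔ Forces V y ψ) :=
  ⟨fun h y hy => ⟨h.1 y hy, h.2 y hy⟩, fun h => ⟨fun y hy => (h y hy).1, fun y hy => (h y hy).2⟩⟩

theorem forces_conj {V : ℕ → Set P} {x : P} {l : List Form} :
    Forces V x (conj l) ↔ ∀ φ ∈ l, Forces V x φ := by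
  induction l with
  | nil => simp [conj, Form.top, Forces]
  | cons φ l ih => simp [conj, Forces, ih]

theorem forces_diagram [Finite Q] {V : ℕ → Set P} {x : P} :
    Forces V x (diagram Q) ↔ ∀ y, x ≤ y → ¬ Forces V y (upVar (Up.empty : Up Q)) ∧
      ∀ U W : Up Q,
        (Forces V y (upVar (U.inter W)) ↔ Forces V y (upVar U) ∧ Forces V y (upVar W)) ∧
        (Forces V y (upVar (U.union W)) ↔ Forces V y (upVar U) ∨ Forces V y (upVar W)) ∧
        (Forces V y (upVar (U.himp W)) ↔
          ∀ z, y ≤ z → Forces V z (upVar U) → Forces V z (upVar W)) := by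
  unfold diagram
  constructor
  · intro h y hy
    refine ⟨fun h' => (forces_iff.1 h.1 y hy).1 h', fun U W => ?_⟩
    let : Fintype (Up Q × Up Q) := Fintype.ofFinite _
    have := forces_conj.1 h.2 _ (List.mem_map_of_mem (Finset.mem_toList.2 (Finset.mem_univ (U, W))))
    exact ⟨forces_iff.1 this.1 y hy, forces_iff.1 this.2.1 y hy, forces_iff.1 this.2.2 y hy⟩
  · intro h
    refine ⟨forces_iff.2 fun y hy => iff_of_false (h y hy).1 id, forces_conj.2 fun φ hφ => ?_⟩
    obtain ⟨⟨U, W⟩, -, rfl⟩ := List.mem_map.1 hφ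
    exact ⟨forces_iff.2 fun y hy => ((h y hy).2 U W).1,
      forces_iff.2 fun y hy => ((h y hy).2 U W).2.1,
      forces_iff.2 fun y hy => ((h y hy).2 U W).2.2⟩

/-- `g` restricts to a p-morphism on the points above `y`. -/
structure IsPMorphismAbove (y : P) (g : P → Q) : Prop where
  mono : ∀ z w, y ≤ z → z ≤ w → g z ≤ g w
  back : ∀ z, y ≤ z → ∀ q, g z ≤ q → ∃ w, z ≤ w ∧ g w = q

theorem IsPMorphismAbove.forces_iff {x : P} {g : P → Q} (hg : IsPMorphismAbove x g)
    (V : ℕ → Set Q) (φ : Form) :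
    ∀ y, x ≤ y → (Forces (fun n => g ⁻¹' V n) y φ ↔ Forces V (g y) φ) := by
  induction φ with
  | var n => exact fun y _ => Iff.rfl
  | bot => exact fun y _ => Iff.rfl
  | and φ ψ ih₁ ih₂ => exact fun y hy => and_congr (ih₁ y hy) (ih₂ y hy)
  | or φ ψ ih₁ ih₂ => exact fun y hy => or_congr (ih₁ y hy) (ih₂ y hy)
  | imp φ ψ ih₁ ih₂ =>
    intro y hy
    constructor
    · intro h q hq hφ
      obtain ⟨w, hw, rfl⟩ := hg.back y hy q hq
      exact (ih₂ w (hy.trans hw)).1 (h w hw ((ih₁ w (hy.trans hw)).2 hφ))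
    · intro h w hw hφ
      exact (ih₂ w (hy.trans hw)).2
        (h (g w) (hg.mono y w hy hw) ((ih₁ w (hy.trans hw)).1 hφ))

/-- A p-morphism from the points above `y` to `Q` that sends `y` to the root and is definable by
the valuation `V` refutes the Yankov formula of `Q` at `y`. -/
theorem IsPMorphismAbove.not_forces_yankov [Finite Q] {V : ℕ → Set P} {y : P} {g : P → Q} {r : Q}
    (hg : IsPMorphismAbove y g) (hr : g y = r)
    (hV : ∀ U : Up Q, ∀ z, y ≤ z → (Forces V z (upVar U) ↔ g z ∈ U.1)) :
    ¬ Forces V y (yankov Q r) := by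
  intro h
  -- The diagram holds at `y`, so the formula would put `g y` outside the points below `r`.
  refine (hV _ y le_rfl).1 (h y le_rfl (forces_diagram.2 fun z hz => ⟨?_, fun U W => ?_⟩)) hr.le
  · rw [hV _ z hz]; exact fun h => h
  · rw [hV _ z hz, hV _ z hz, hV _ z hz, hV _ z hz, hV _ z hz]
    refine ⟨Iff.rfl, Iff.rfl, ?_, ?_⟩
    · intro h w hw
      rw [hV _ w (hz.trans hw), hV _ w (hz.trans hw)]
      exact h (g w) (hg.mono z w hz hw)
    · intro h q hq hU
      obtain ⟨w, hw, rfl⟩ := hg.back z hz q hq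
      have := h w hw
      rw [hV _ w (hz.trans hw), hV _ w (hz.trans hw)] at this
      exact this hU

/-- The index of the variable `p_U`. -/
noncomputable def upCode [Finite Q] (U : Up Q) : ℕ := Finite.equivFin (Up Q) U

theorem upCode_injective [Finite Q] : Function.Injective (upCode : Up Q → ℕ) :=
  fun _ _ h => (Finite.equivFin (Up Q)).injective (Fin.ext h)

/-- For validity every upset may serve as a valuation, so definability of `g` is automatic. -/
theorem IsPMorphismAbove.not_validates_yankov [Finite Q] {y : P} {g : P → Q} {r : Q}
    (hg : IsPMorphismAbove y g) (hr : g y = r) : ¬ Validates P (yankov Q r) := by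
  intro h
  let V : ℕ → Set P := fun n => {z | ∃ U : Up Q, upCode U = n ∧ y ≤ z ∧ g z ∈ U.1}
  refine hg.not_forces_yankov (V := V) hr (fun U z hz => ⟨?_, fun hU => ⟨U, rfl, hz, hU⟩⟩)
    (h V ?_ y)
  · rintro ⟨W, hW, -, h⟩
    rwa [upCode_injective hW] at h
  · rintro n a b hab ⟨U, hU, hya, hgU⟩
    exact ⟨U, hU, hya.trans hab, U.2 (hg.mono a b hya hab) hgU⟩

/-- The upset of the points above `q`. -/
def Up.above (q : Q) : Up Q := ⟨Set.Ici q, isUpperSet_Ici q⟩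

/-- A point that forces the diagram of `Q` satisfies exactly the variables of a prime filter of
upsets, which is generated by a point of `Q`. -/
theorem exists_forces_upVar_iff [Finite Q] {V : ℕ → Set P} {z : P}
    (h : Forces V z (diagram Q)) : ∃ q : Q, ∀ U : Up Q, Forces V z (upVar U) ↔ q ∈ U.1 := by
  obtain ⟨h0, h⟩ := forces_diagram.1 h z le_rfl
  have hmono : ∀ U W : Up Q, U.1 ⊆ W.1 → Forces V z (upVar U) → Forces V z (upVar W) := by
    intro U W hUW hU
    refine ((h U W).1.1 ?_).2
    rwa [show U.inter W = U from Subtype.ext (Set.inter_eq_left.2 hUW)]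
  have hne : {U : Up Q | Forces V z (upVar U)}.Nonempty :=
    -- The implication `∅ ⇒ ∅` is the whole of `Q`.
    ⟨Up.empty.himp Up.empty, (h _ _).2.2.2 fun _ _ h => h⟩
  obtain ⟨U, hU⟩ := (Set.toFinite _).exists_minimal hne
  have hUz : Forces V z (upVar U) := hU.prop
  have hleast : ∀ W : Up Q, Forces V z (upVar W) → U.1 ⊆ W.1 := by
    intro W hW
    have h1 : Forces V z (upVar (U.inter W)) := (h U W).1.2 ⟨hUz, hW⟩
    have h2 : U ≤ U.inter W := hU.le_of_le h1 (fun _ hx => hx.1)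
    exact fun x hx => (h2 hx).2
  have hUne : U.1.Nonempty := by
    by_contra hemp
    refine h0 (hmono U _ ?_ hUz)
    rw [Set.not_nonempty_iff_eq_empty.1 hemp]
    exact Set.empty_subset _
  obtain ⟨q, hq⟩ := (Set.toFinite U.1).exists_minimal hUne
  have key : Forces V z (upVar (Up.above q)) := by
    -- As `q` is minimal in `U`, the cone of `q` and the rest of `U` cover `U`; leastness of `U`
    -- rules out the rest, which omits `q`.
    have h1 : Forces V z (upVar ((Up.above q).union (U.inter (Up.notBelow q)))) := by
      refine hmono U _ ?_ hUz
      intro x hx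
      by_cases hxq : x ≤ q
      · exact Or.inl (hq.le_of_le hx hxq)
      · exact Or.inr ⟨hx, hxq⟩
    rcases (h _ _).2.1.1 h1 with h2 | h2
    · exact h2
    · exact absurd le_rfl (hleast _ h2 hq.prop).2
  refine ⟨q, fun W => ⟨fun hW => hleast W hW hq.prop, fun hW => hmono _ W ?_ key⟩⟩
  exact fun x hx => W.2 hx hW

/-- Converse of the refutation lemmas: above a point that forces the diagram but not the conclusion,
send each point to the element of `Q` generating its prime filter of upsets. -/
theorem exists_isPMorphismAbove [Finite Q] {r : Q} (hr : ∀ q, r ≤ q)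
    (h : ¬ Validates P (yankov Q r)) :
    ∃ (y : P) (g : P → Q), IsPMorphismAbove y g ∧ g y = r := by
  classical
  simp only [Validates, not_forall] at h
  obtain ⟨V, hV, x, hx⟩ := h
  simp only [yankov, Forces, not_forall] at hx
  obtain ⟨y, -, hy, hyr⟩ := hx
  have hex : ∀ z, ∃ q : Q, y ≤ z → ∀ U : Up Q, Forces V z (upVar U) ↔ q ∈ U.1 := by
    intro z
    by_cases hz : y ≤ z
    · obtain ⟨q, hq⟩ := exists_forces_upVar_iff (Forces.mono hV _ hz hy)
      exact ⟨q, fun _ => hq⟩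
    · exact ⟨r, fun h => absurd h hz⟩
  choose g hg using hex
  refine ⟨y, g, ⟨?_, ?_⟩, ?_⟩
  · intro z w hz hw
    have h1 := (hg z hz (Up.above (g z))).2 (le_refl (g z))
    exact (hg w (hz.trans hw) (Up.above (g z))).1 (Forces.mono hV _ hw h1)
  · intro z hz q hq
    by_contra hcon
    push Not at hcon
    -- If no point above `z` goes to `q`, every such point in the cone of `q` avoids `q` itself;
    -- this implication then holds at `z` but fails at `q ≥ g z`.
    have h1 : Forces V z (upVar ((Up.above q).himp (Up.notBelow q))) := by
      refine ((forces_diagram.1 hy z hz).2 _ _).2.2.2 fun w hw h => ?_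
      rw [hg w (hz.trans hw)] at h ⊢
      exact fun h' => hcon w hw (le_antisymm h' h)
    exact ((hg z hz _).1 h1) q hq (le_refl q) (le_refl q)
  · rw [hg y le_rfl] at hyr
    exact le_antisymm (not_not.1 hyr) (hr _)

end Kripke

/-! ### Prime filters -/

/-- The prime filters of a Heyting algebra. -/
@[ext] structure PrimeFilter (H : Type u) [HeytingAlgebra H] where
  carrier : Set H
  upper : IsUpperSet carrier
  inf_mem : ∀ {a b}, a ∈ carrier → b ∈ carrier → a ⊓ b ∈ carrier
  top_mem : ⊤ ∈ carrier
  bot_notMem : ⊥ ∉ carrier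
  mem_or_mem : ∀ {a b}, a ⊔ b ∈ carrier → a ∈ carrier ∨ b ∈ carrier

namespace PrimeFilter

variable {H : Type u} [HeytingAlgebra H]

instance : Membership H (PrimeFilter H) := ⟨fun x a => a ∈ x.carrier⟩

instance : PartialOrder (PrimeFilter H) :=
  PartialOrder.lift PrimeFilter.carrier fun _ _ => PrimeFilter.ext

theorem mem_of_le {x : PrimeFilter H} {a b : H} (h : a ≤ b) (ha : a ∈ x) : b ∈ x := x.upper h ha

theorem mem_inf_iff {x : PrimeFilter H} {a b : H} : a ⊓ b ∈ x ↔ a ∈ x ∧ b ∈ x :=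
  ⟨fun h => ⟨mem_of_le inf_le_left h, mem_of_le inf_le_right h⟩, fun h => x.inf_mem h.1 h.2⟩

theorem mem_sup_iff {x : PrimeFilter H} {a b : H} : a ⊔ b ∈ x ↔ a ∈ x ∨ b ∈ x :=
  ⟨x.mem_or_mem, fun h => h.elim (mem_of_le le_sup_left) (mem_of_le le_sup_right)⟩

/-- The prime filter theorem. -/
theorem exists_subset_notMem {F : Set H} (hne : F.Nonempty) (hup : IsUpperSet F)
    (hinf : ∀ a ∈ F, ∀ b ∈ F, a ⊓ b ∈ F) {b : H} (hb : b ∉ F) :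
    ∃ x : PrimeFilter H, F ⊆ x.carrier ∧ b ∉ x := by
  have hF : Order.IsPFilter F := Order.IsPFilter.of_def hne
    (fun a ha c hc => ⟨a ⊓ c, hinf a ha c hc, inf_le_left, inf_le_right⟩)
    (fun {a c} hac ha => hup hac ha)
  have hdis : Disjoint (hF.toPFilter : Set H) (Order.Ideal.principal b : Set H) := by
    rw [Set.disjoint_left]
    intro a ha hab
    exact hb (hup (Order.Ideal.mem_principal.1 hab) ha)
  obtain ⟨J, hJ, hIJ, hFJ⟩ := DistribLattice.prime_ideal_of_disjoint_filter_ideal hdis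
  refine ⟨⟨(J : Set H)ᶜ, ?_, ?_, ?_, ?_, ?_⟩, ?_, ?_⟩
  · exact fun a c hac ha hc => ha (J.lower hac hc)
  · exact fun {a c} ha hc h => (hJ.mem_or_mem h).elim ha hc
  · intro h
    refine Set.disjoint_left.1 hFJ ?_ h
    obtain ⟨a, ha⟩ := hne
    exact hup le_top ha
  · exact fun h => h J.bot_mem
  · intro a c h
    by_contra hcon
    push Not at hcon
    exact h (Order.Ideal.sup_mem (not_not.1 hcon.1) (not_not.1 hcon.2))
  · exact fun a ha h => Set.disjoint_left.1 hFJ ha h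
  · exact fun h => h (hIJ (Order.Ideal.mem_principal.2 le_rfl))

/-- The filter generated by `x` and `a` omits `b`, so the prime filter theorem applies to it. -/
theorem exists_le_notMem {x : PrimeFilter H} {a b : H} (h : a ⇨ b ∉ x) :
    ∃ y, x ≤ y ∧ a ∈ y ∧ b ∉ y := by
  obtain ⟨y, hy, hb⟩ := exists_subset_notMem (F := {c | ∃ d ∈ x, d ⊓ a ≤ c}) (b := b)
    ⟨⊤, ⊤, x.top_mem, le_top⟩ (fun c c' hc ⟨d, hd, h⟩ => ⟨d, hd, h.trans hc⟩)
    (fun c ⟨d, hd, h⟩ c' ⟨d', hd', h'⟩ => ⟨d ⊓ d', x.inf_mem hd hd', le_inf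
      ((inf_le_inf_right a inf_le_left).trans h) ((inf_le_inf_right a inf_le_right).trans h')⟩)
    (fun ⟨d, hd, hdb⟩ => h (mem_of_le (le_himp_iff.2 hdb) hd))
  exact ⟨y, fun c hc => hy ⟨c, hc, inf_le_left⟩, hy ⟨⊤, x.top_mem, inf_le_right⟩, hb⟩

theorem mem_himp_iff {x : PrimeFilter H} {a b : H} :
    a ⇨ b ∈ x ↔ ∀ y, x ≤ y → a ∈ y → b ∈ y := by
  refine ⟨fun h y hy ha => mem_of_le himp_inf_le (y.inf_mem (hy h) ha), fun h => ?_⟩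
  by_contra hcon
  obtain ⟨y, hy, ha, hb⟩ := exists_le_notMem hcon
  exact hb (h y hy ha)

theorem exists_mem_notMem {a b : H} (h : ¬ a ≤ b) : ∃ x : PrimeFilter H, a ∈ x ∧ b ∉ x := by
  obtain ⟨x, hx, hb⟩ := exists_subset_notMem (F := Set.Ici a) (b := b) ⟨a, le_rfl⟩
    (isUpperSet_Ici a) (fun c hc d hd => le_inf hc hd) h
  exact ⟨x, hx le_rfl, hb⟩

theorem eq_of_forall_mem_iff {a b : H} (h : ∀ x : PrimeFilter H, a ∈ x ↔ b ∈ x) : a = b := by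
  apply le_antisymm <;> by_contra hcon <;> obtain ⟨x, h1, h2⟩ := exists_mem_notMem hcon
  · exact h2 ((h x).1 h1)
  · exact h2 ((h x).2 h1)

theorem forces_iff (a : ℕ → H) (φ : Form) : ∀ x : PrimeFilter H,
    Forces (fun n => {y : PrimeFilter H | a n ∈ y}) x φ ↔ φ.eval a ∈ x := by
  induction φ with
  | var n => exact fun x => Iff.rfl
  | bot => exact fun x => iff_of_false id x.bot_notMem
  | and φ ψ ih₁ ih₂ => exact fun x => (and_congr (ih₁ x) (ih₂ x)).trans mem_inf_iff.symm
  | or φ ψ ih₁ ih₂ => exact fun x => (or_congr (ih₁ x) (ih₂ x)).trans mem_sup_iff.symm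
  | imp φ ψ ih₁ ih₂ =>
    exact fun x => (forall_congr' fun y => imp_congr_right fun _ =>
      imp_congr (ih₁ y) (ih₂ y)).trans mem_himp_iff.symm

/-- A prime filter is total if it contains all dense elements. -/
def Total (x : PrimeFilter H) : Prop := ∀ d : H, dᶜ = ⊥ → d ∈ x

theorem Total.mono {x y : PrimeFilter H} (h : Total x) (hxy : x ≤ y) : Total y :=
  fun d hd => hxy (h d hd)

theorem dense_sup_compl (a : H) : (a ⊔ aᶜ)ᶜ = ⊥ := by
  rw [compl_sup, inf_compl_self]

theorem dense_mono {a b : H} (hab : a ≤ b) (ha : aᶜ = ⊥) : bᶜ = ⊥ :=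
  le_bot_iff.1 ((compl_anti hab).trans ha.le)

/-- Each `a ⊔ aᶜ` is dense, so a total filter already decides every element and cannot grow. -/
theorem Total.eq_of_le {x y : PrimeFilter H} (h : Total x) (hxy : x ≤ y) : y = x := by
  refine le_antisymm (fun a ha => ?_) hxy
  rcases mem_sup_iff.1 (h _ (dense_sup_compl a)) with h1 | h1
  · exact h1
  · refine absurd (y.inf_mem ha (hxy h1)) ?_
    rw [inf_compl_self]
    exact y.bot_notMem

/-- The dense elements form a filter, and it is compatible with `x`: if `a ⊓ d = ⊥` with `d` dense,
then `a ≤ dᶜ = ⊥`. -/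
theorem exists_total_ge (x : PrimeFilter H) : ∃ y, x ≤ y ∧ Total y := by
  obtain ⟨y, hy, -⟩ := exists_subset_notMem (F := {c | ∃ a ∈ x, ∃ d : H, dᶜ = ⊥ ∧ a ⊓ d ≤ c})
    (b := ⊥) ⟨⊤, ⊤, x.top_mem, ⊤, compl_top, le_top⟩
    (fun c c' hc ⟨a, ha, d, hd, h⟩ => ⟨a, ha, d, hd, h.trans hc⟩)
    (fun c ⟨a, ha, d, hd, h⟩ c' ⟨a', ha', d', hd', h'⟩ =>
      ⟨a ⊓ a', x.inf_mem ha ha', d ⊓ d', by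
        rw [← compl_compl_compl, compl_compl_inf_distrib, ← compl_compl_inf_distrib,
          compl_compl_inf_distrib, hd, hd', compl_bot, inf_top_eq, compl_top],
        le_inf ((inf_le_inf inf_le_left inf_le_left).trans h)
          ((inf_le_inf inf_le_right inf_le_right).trans h')⟩)
    (fun ⟨a, ha, d, hd, h⟩ => x.bot_notMem
      (mem_of_le ((le_compl_iff_disjoint_right.2 (disjoint_iff_inf_le.2 h)).trans hd.le) ha))
  exact ⟨y, fun a ha => hy ⟨a, ha, ⊤, compl_top, inf_le_left⟩,
    fun d hd => hy ⟨⊤, x.top_mem, d, hd, inf_le_right⟩⟩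

end PrimeFilter

/-! ### The diamond -/

section Diamond

variable {X : Type u} [PartialOrder X]

/-- A point of the diamond. -/
def Q6.pt (i : Fin 4) : Q6 := i

theorem Q6.pt_le {i j : Fin 4} : Q6.pt i ≤ Q6.pt j ↔ i = j ∨ i = 0 ∨ j = 3 := Iff.rfl

/-- Above `z`, the set `A` is contained in `B`. -/
def SubsetAbove (A B : Set X) (z : X) : Prop := ∀ w, z ≤ w → w ∈ A → w ∈ B

theorem SubsetAbove.mono {A B : Set X} {z w : X} (h : SubsetAbove A B z) (hzw : z ≤ w) :
    SubsetAbove A B w := fun v hv => h v (hzw.trans hv)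

theorem subsetAbove_of_mem {A B : Set X} (hB : IsUpperSet B) {z : X} (hz : z ∈ B) :
    SubsetAbove A B z := fun _ hv _ => hB hv hz

theorem exists_of_not_subsetAbove {A B : Set X} {z : X} (h : ¬ SubsetAbove A B z) :
    ∃ w, z ≤ w ∧ w ∈ A ∧ w ∉ B := by
  simpa only [SubsetAbove, not_forall, exists_prop] using h

open Classical in
/-- The map onto the diamond that is given by two upsets. -/
noncomputable def diamondMap (A B : Set X) (z : X) : Q6 :=
  Q6.pt (if SubsetAbove A B z then if SubsetAbove B A z then 3 else 1
    else if SubsetAbove B A z then 2 else 0)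

/-- Both inclusions persist upwards, which gives monotonicity. A witness in `A` but not `B` goes to
`2`, one in `B` but not `A` goes to `1`, and `hAB` supplies a point over `3`. -/
theorem diamondMap_isPMorphismAbove {A B : Set X} (hA : IsUpperSet A) (hB : IsUpperSet B)
    {r : X} (hAB : ∀ z, r ≤ z → ∃ w, z ≤ w ∧ w ∈ A ∧ w ∈ B) :
    IsPMorphismAbove r (diamondMap A B) := by
  classical
  constructor
  · intro z w _ hzw
    have h1 : SubsetAbove A B z → SubsetAbove A B w := fun h => h.mono hzw
    have h2 : SubsetAbove B A z → SubsetAbove B A w := fun h => h.mono hzw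
    rw [diamondMap, diamondMap, Q6.pt_le]
    split_ifs <;> simp_all
  · intro z hz q hq
    have h3 : ∃ w, z ≤ w ∧ diamondMap A B w = Q6.pt 3 := by
      obtain ⟨w, hw, ha, hb⟩ := hAB z hz
      exact ⟨w, hw, by
        rw [diamondMap, if_pos (subsetAbove_of_mem hB hb), if_pos (subsetAbove_of_mem hA ha)]⟩
    have h1 : ¬ SubsetAbove B A z → ∃ w, z ≤ w ∧ diamondMap A B w = Q6.pt 1 := by
      intro h
      obtain ⟨w, hw, hb, ha⟩ := exists_of_not_subsetAbove h
      exact ⟨w, hw, by rw [diamondMap, if_pos (subsetAbove_of_mem hB hb),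
        if_neg fun h => ha (h w le_rfl hb)]⟩
    have h2 : ¬ SubsetAbove A B z → ∃ w, z ≤ w ∧ diamondMap A B w = Q6.pt 2 := by
      intro h
      obtain ⟨w, hw, ha, hb⟩ := exists_of_not_subsetAbove h
      exact ⟨w, hw, by rw [diamondMap, if_neg fun h => hb (h w le_rfl ha),
        if_pos (subsetAbove_of_mem hA ha)]⟩
    have h0 : diamondMap A B z = q → ∃ w, z ≤ w ∧ diamondMap A B w = q := fun h => ⟨z, le_rfl, h⟩
    obtain ⟨i, hi⟩ : ∃ i, Q6.pt i = q := ⟨q, rfl⟩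
    rw [← hi] at hq h0 ⊢
    clear hi
    by_cases hS : SubsetAbove A B z <;> by_cases hT : SubsetAbove B A z <;>
      simp only [diamondMap, hS, hT, if_true, if_false, Q6.pt_le] at hq h0 h1 h2 h3 ⊢ <;>
      fin_cases i <;> simp_all

theorem diamondMap_eq_zero {A B : Set X} {r x y : X} (hx : r ≤ x) (hxA : x ∈ A) (hxB : x ∉ B)
    (hy : r ≤ y) (hyB : y ∈ B) (hyA : y ∉ A) : diamondMap A B r = (0 : Fin 4) := by
  rw [diamondMap, if_neg fun h => hxB (h x hx hxA), if_neg fun h => hyA (h y hy hyB)]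
  rfl

end Diamond

theorem yankov_Q6_mem : yankov Q6 (0 : Fin 4) ∈ combAxioms := by simp [combAxioms]

theorem yankov_Q8_mem : yankov Q8 (0 : Fin 4) ∈ combAxioms := by simp [combAxioms]

/-! ### The diamond map on prime filters -/

namespace PrimeFilter

variable {H : Type u} [HeytingAlgebra H]

open Classical in
/-- The element of a Heyting algebra that corresponds to an upset of the diamond, given two
elements of the algebra. -/
noncomputable def diamondElement (a b : H) (U : Up Q6) : H :=
  if Q6.pt 0 ∈ U.1 then ⊤
  else if Q6.pt 1 ∈ U.1 then if Q6.pt 2 ∈ U.1 then (a ⇨ b) ⊔ (b ⇨ a) else a ⇨ b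
  else if Q6.pt 2 ∈ U.1 then b ⇨ a
  else if Q6.pt 3 ∈ U.1 then (a ⇨ b) ⊓ (b ⇨ a) else ⊥

/-- Inclusion above `z` is membership of `a ⇨ b` in `z`, so preimages of upsets under the diamond
map are definable. -/
theorem diamondElement_mem_iff {a b : H} (U : Up Q6) (z : PrimeFilter H) :
    diamondElement a b U ∈ z ↔ diamondMap {x : PrimeFilter H | a ∈ x} {x | b ∈ x} z ∈ U.1 := by
  classical
  have h01 : Q6.pt 0 ∈ U.1 → Q6.pt 1 ∈ U.1 := U.2 (Q6.pt_le.2 (by simp))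
  have h02 : Q6.pt 0 ∈ U.1 → Q6.pt 2 ∈ U.1 := U.2 (Q6.pt_le.2 (by simp))
  have h13 : Q6.pt 1 ∈ U.1 → Q6.pt 3 ∈ U.1 := U.2 (Q6.pt_le.2 (by simp))
  have h23 : Q6.pt 2 ∈ U.1 → Q6.pt 3 ∈ U.1 := U.2 (Q6.pt_le.2 (by simp))
  have hS : SubsetAbove {x : PrimeFilter H | a ∈ x} {x | b ∈ x} z ↔ a ⇨ b ∈ z :=
    mem_himp_iff.symm
  have hT : SubsetAbove {x : PrimeFilter H | b ∈ x} {x | a ∈ x} z ↔ b ⇨ a ∈ z :=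
    mem_himp_iff.symm
  have htop : (⊤ : H) ∈ z := z.top_mem
  have hbot : (⊥ : H) ∉ z := z.bot_notMem
  by_cases c0 : Q6.pt 0 ∈ U.1 <;> by_cases c1 : Q6.pt 1 ∈ U.1 <;> by_cases c2 : Q6.pt 2 ∈ U.1 <;>
    by_cases c3 : Q6.pt 3 ∈ U.1 <;> by_cases hu : a ⇨ b ∈ z <;> by_cases hv : b ⇨ a ∈ z <;>
    simp_all [diamondElement, diamondMap, mem_inf_iff, mem_sup_iff]

/-- If `H` validates the Yankov formula of the diamond, then the points above a given one that are
not total form a chain. -/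
theorem le_or_le_of_not_total (hH : ∀ a : ℕ → H, (yankov Q6 (0 : Fin 4)).eval a = ⊤)
    {r x y : PrimeFilter H} (hx : r ≤ x) (hy : r ≤ y) (hx' : ¬ Total x) (hy' : ¬ Total y) :
    x ≤ y ∨ y ≤ x := by
  by_contra hcon
  push Not at hcon
  obtain ⟨a, hax, hay⟩ := Set.not_subset.1 hcon.1
  obtain ⟨b, hby, hbx⟩ := Set.not_subset.1 hcon.2
  simp only [Total, not_forall] at hx' hy'
  obtain ⟨d, hd, hdx⟩ := hx'
  obtain ⟨e, he, hey⟩ := hy'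
  -- Joining the dense `e` to `a` and `d` to `b` puts every total filter in both sets, while
  -- primeness keeps `x` out of the second and `y` out of the first.
  have hA : IsUpperSet {x : PrimeFilter H | a ⊔ e ∈ x} := fun _ _ h h' => h h'
  have hB : IsUpperSet {x : PrimeFilter H | b ⊔ d ∈ x} := fun _ _ h h' => h h'
  refine (diamondMap_isPMorphismAbove (r := r) hA hB fun z _ => ?_).not_forces_yankov
    (diamondMap_eq_zero hx (mem_sup_iff.2 (Or.inl hax)) (fun h => (mem_sup_iff.1 h).elim hbx hdx)
      hy (mem_sup_iff.2 (Or.inl hby)) (fun h => (mem_sup_iff.1 h).elim hay hey))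
    (V := fun n => {z | Function.extend upCode (diamondElement (a ⊔ e) (b ⊔ d)) ⊥ n ∈ z})
    (fun U z _ => ?_) ?_
  · obtain ⟨w, hw, htot⟩ := exists_total_ge z
    exact ⟨w, hw, htot _ (dense_mono le_sup_right he), htot _ (dense_mono le_sup_right hd)⟩
  · rw [← diamondElement_mem_iff, ← upCode_injective.extend_apply (diamondElement _ _) ⊥ U]
    rfl
  · rw [forces_iff, hH]
    exact r.top_mem

end PrimeFilter

/-! ### Local finiteness -/

section LocalFiniteness

open PrimeFilter

variable {H : Type u} [HeytingAlgebra H] (S : Set H)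

/-- The generators that belong to a prime filter. -/
def colour (x : PrimeFilter H) : Set S := {g | (g : H) ∈ x}

/-- The local type of a prime filter: whether it is total, its colour, and the colours of the total
prime filters above it. -/
def localType (x : PrimeFilter H) : Prop × Set S × Set (Set S) :=
  (Total x, colour S x, colour S '' {m | x ≤ m ∧ Total m})

/-- The set of all local types of the prime filters above a given one. -/
def upType (x : PrimeFilter H) : Set (Prop × Set S × Set (Set S)) := localType S '' Set.Ici x

variable {S}

theorem colour_mono {x y : PrimeFilter H} (h : x ≤ y) : colour S x ⊆ colour S y :=
  fun _ hg => h hg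

/-- The only total filter above a total one is itself. -/
theorem localType_eq_of_total {x y : PrimeFilter H} (hx : Total x) (hy : Total y)
    (h : colour S x = colour S y) : localType S x = localType S y := by
  have aux : ∀ x : PrimeFilter H, Total x → {m | x ≤ m ∧ Total m} = {x} := fun x hx => by
    ext m
    exact ⟨fun h => hx.eq_of_le h.1, fun h => by rw [Set.mem_singleton_iff.1 h]; exact ⟨le_rfl, hx⟩⟩
  simp only [localType, aux x hx, aux y hy, Set.image_singleton, h, hx, hy]

/-- The heart of local finiteness: once the types available below are related, matching the local
type of a single point matches everything above it. -/
theorem upType_subset (hH : ∀ a : ℕ → H, (yankov Q6 (0 : Fin 4)).eval a = ⊤)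
    {x y x' y' : PrimeFilter H} (hx : x ≤ x') (hy : y ≤ y') (h : upType S y ⊆ upType S x)
    (h' : localType S x' = localType S y') : upType S y' ⊆ upType S x' := by
  simp only [localType, Prod.mk.injEq] at h'
  obtain ⟨htot, hcol, hmcol⟩ := h'
  rintro _ ⟨w, hw, rfl⟩
  by_cases hwt : Total w
  · have : colour S w ∈ colour S '' {m | x' ≤ m ∧ Total m} := hmcol ▸ ⟨w, ⟨hw, hwt⟩, rfl⟩
    obtain ⟨m, ⟨hm, hmt⟩, hmw⟩ := this
    exact ⟨m, hm, localType_eq_of_total hmt hwt hmw⟩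
  obtain ⟨z, hz, hzw⟩ := h ⟨w, hy.trans hw, rfl⟩
  have hzw' := hzw
  simp only [localType, Prod.mk.injEq] at hzw'
  obtain ⟨hztot, hzcol, hzmcol⟩ := hzw'
  have hx't : ¬ Total x' := fun h => hwt ((htot ▸ h : Total y').mono hw)
  rcases le_or_le_of_not_total hH hx hz hx't (hztot ▸ hwt) with h1 | h1
  · exact ⟨z, h1, hzw⟩
  -- Here `x'` lies above `z`, whose type is that of `w`, and has the type of `y'`, which lies below
  -- `w`; the colours are squeezed into equality, so `x'` itself realises the type of `w`.
  · refine ⟨x', Set.mem_Ici.2 le_rfl, ?_⟩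
    rw [← hzw]
    simp only [localType, Prod.mk.injEq]
    refine ⟨?_, ?_, ?_⟩
    · rw [hztot]
      exact propext (iff_of_false hx't hwt)
    · refine subset_antisymm ?_ (colour_mono h1)
      rw [hcol, hzcol]
      exact colour_mono hw
    · refine subset_antisymm (Set.image_mono fun m hm => ⟨h1.trans hm.1, hm.2⟩) ?_
      rw [hzmcol, hmcol]
      exact Set.image_mono fun m hm => ⟨le_trans hw hm.1, hm.2⟩

/-- This is the zigzag condition for the relation of having equal `upType`. -/
theorem exists_upType_eq (hH : ∀ a : ℕ → H, (yankov Q6 (0 : Fin 4)).eval a = ⊤)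
    {x y x' : PrimeFilter H} (hx : x ≤ x') (h : upType S x = upType S y) :
    ∃ y', y ≤ y' ∧ upType S x' = upType S y' := by
  have : localType S x' ∈ upType S y := h ▸ ⟨x', hx, rfl⟩
  obtain ⟨y', hy, hy'⟩ := this
  exact ⟨y', hy, subset_antisymm (upType_subset hH hy hx h.subset hy')
    (upType_subset hH hx hy h.superset hy'.symm)⟩

theorem Generated.mem_iff_of_upType_eq
    (hH : ∀ a : ℕ → H, (yankov Q6 (0 : Fin 4)).eval a = ⊤) {a : H} (ha : Generated S a) :
    ∀ {x y : PrimeFilter H}, upType S x = upType S y → (a ∈ x ↔ a ∈ y) := by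
  induction ha with
  | @basic g hg =>
    -- Colours only grow upwards, so a generator lies in `x` exactly when it lies in all colours
    -- recorded above `x`.
    have aux : ∀ x : PrimeFilter H, g ∈ x ↔ ∀ τ ∈ upType S x, (⟨g, hg⟩ : S) ∈ τ.2.1 := by
      intro x
      constructor
      · rintro h _ ⟨z, hz, rfl⟩
        exact hz h
      · exact fun h => h _ ⟨x, Set.mem_Ici.2 le_rfl, rfl⟩
    intro x y h
    rw [aux, aux, h]
  | bot => exact fun {x y} _ => iff_of_false x.bot_notMem y.bot_notMem
  | inf _ _ ih₁ ih₂ => exact fun h => by rw [mem_inf_iff, mem_inf_iff, ih₁ h, ih₂ h]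
  | sup _ _ ih₁ ih₂ => exact fun h => by rw [mem_sup_iff, mem_sup_iff, ih₁ h, ih₂ h]
  | @himp a b _ _ ih₁ ih₂ =>
    have aux : ∀ {x y : PrimeFilter H}, upType S x = upType S y → a ⇨ b ∈ x → a ⇨ b ∈ y := by
      intro x y h hab
      rw [mem_himp_iff] at hab ⊢
      intro y' hy hay
      obtain ⟨x', hx, hx'⟩ := exists_upType_eq hH hy h.symm
      exact (ih₂ hx').2 (hab x' hx ((ih₁ hx').1 hay))
    intro x y h
    exact ⟨aux h, aux h.symm⟩

/-- A Heyting algebra that validates the Yankov formula of the diamond is locally finite. -/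
theorem locallyFiniteAlgebra_of_yankov_Q6
    (hH : ∀ a : ℕ → H, (yankov Q6 (0 : Fin 4)).eval a = ⊤) : LocallyFiniteAlgebra H := by
  intro S hS
  have : Finite S := hS
  -- The image lies in a finite iterated power set; on generated elements the map is injective, as
  -- they are unions of bisimulation classes.
  refine Set.Finite.of_finite_image (f := fun a : H => upType S '' {x | a ∈ x})
    (Set.toFinite _) ?_
  have aux : ∀ a b : H, Generated S b →
      upType S '' {x | a ∈ x} = upType S '' {x | b ∈ x} → ∀ x : PrimeFilter H, a ∈ x → b ∈ x := by
    intro a b hb h x hx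
    have : upType S x ∈ upType S '' {x | b ∈ x} := h ▸ ⟨x, hx, rfl⟩
    obtain ⟨y, hy, hyx⟩ := this
    exact (hb.mem_iff_of_upType_eq hH hyx).1 hy
  exact fun a ha b hb h => eq_of_forall_mem_iff fun x => ⟨aux a b hb h x, aux b a ha h.symm x⟩

end LocalFiniteness

/-! ### The Lindenbaum algebra -/

section Lindenbaum

variable {Γ : Set Form} {φ ψ χ θ : Form}

/-! ### Derived rules and the quotient algebra -/

namespace Provable

theorem weaken (h : Provable Γ φ) (ψ : Form) : Provable Γ (imp ψ φ) := mp (k φ ψ) h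

theorem imp_mp (h : Provable Γ (imp χ (imp φ ψ))) (h' : Provable Γ (imp χ φ)) :
    Provable Γ (imp χ ψ) := mp (mp (s χ φ ψ) h) h'

theorem imp_refl (φ : Form) : Provable Γ (imp φ φ) := imp_mp (k φ (imp φ φ)) (k φ φ)

theorem imp_trans (h : Provable Γ (imp φ ψ)) (h' : Provable Γ (imp ψ χ)) :
    Provable Γ (imp φ χ) := imp_mp (weaken h' φ) h

theorem imp_and (h : Provable Γ (imp χ φ)) (h' : Provable Γ (imp χ ψ)) :
    Provable Γ (imp χ (and φ ψ)) := imp_mp (imp_trans h (andIntro φ ψ)) h'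

theorem or_imp (h : Provable Γ (imp φ χ)) (h' : Provable Γ (imp ψ χ)) :
    Provable Γ (imp (or φ ψ) χ) := mp (mp (orElim φ ψ χ) h) h'

theorem curry (h : Provable Γ (imp (and φ ψ) χ)) : Provable Γ (imp φ (imp ψ χ)) := by
  have h1 : Provable Γ (imp φ (imp ψ (imp (and φ ψ) χ))) := weaken (weaken h ψ) φ
  have h2 : Provable Γ (imp φ (imp (imp ψ (and φ ψ)) (imp ψ χ))) := imp_trans h1 (s _ _ _)
  exact imp_mp h2 (andIntro φ ψ)

theorem uncurry (h : Provable Γ (imp φ (imp ψ χ))) : Provable Γ (imp (and φ ψ) χ) :=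
  imp_mp (imp_trans (andLeft φ ψ) h) (andRight φ ψ)

end Provable

open Provable

/-- Formulas, preordered by `Γ`-provable implication. -/
def PreLindenbaum (_ : Set Form) : Type := Form

instance : Preorder (PreLindenbaum Γ) where
  le φ ψ := Provable Γ (imp φ ψ)
  le_refl φ := imp_refl φ
  le_trans _ _ _ h h' := imp_trans h h'

variable (Γ) in
/-- The Lindenbaum algebra of `IPC ⊕ Γ`. -/
def Lindenbaum : Type := Antisymmetrization (PreLindenbaum Γ) (· ≤ ·)

instance : PartialOrder (Lindenbaum Γ) :=
  inferInstanceAs (PartialOrder (Antisymmetrization (PreLindenbaum Γ) (· ≤ ·)))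

variable (Γ) in
/-- The class of a formula. -/
def Lindenbaum.mk (φ : Form) : Lindenbaum Γ :=
  toAntisymmetrization (α := PreLindenbaum Γ) (· ≤ ·) φ

theorem Lindenbaum.mk_le_mk : mk Γ φ ≤ mk Γ ψ ↔ Provable Γ (imp φ ψ) := Iff.rfl

theorem Lindenbaum.exists_mk (a : Lindenbaum Γ) : ∃ φ, mk Γ φ = a :=
  ⟨ofAntisymmetrization (α := PreLindenbaum Γ) (· ≤ ·) a, toAntisymmetrization_ofAntisymmetrization _ _⟩

/-- A monotone-or-antitone binary connective acts on the Lindenbaum algebra. -/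
noncomputable def Lindenbaum.map₂ (f : Form → Form → Form) (a b : Lindenbaum Γ) : Lindenbaum Γ :=
  mk Γ (f a.exists_mk.choose b.exists_mk.choose)

/-- Requiring provable equivalence in both arguments lets one lemma cover implication, which is
antitone on the left. -/
theorem Lindenbaum.map₂_mk {f : Form → Form → Form}
    (hf : ∀ {φ φ' ψ ψ'}, Provable Γ (imp φ φ') → Provable Γ (imp φ' φ) → Provable Γ (imp ψ ψ') →
      Provable Γ (imp ψ' ψ) → Provable Γ (imp (f φ ψ) (f φ' ψ'))) (φ ψ : Form) :
    map₂ f (mk Γ φ) (mk Γ ψ) = mk Γ (f φ ψ) := by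
  have h1 := (mk Γ φ).exists_mk.choose_spec
  have h2 := (mk Γ ψ).exists_mk.choose_spec
  exact le_antisymm (mk_le_mk.2 (hf (mk_le_mk.1 h1.le) (mk_le_mk.1 h1.ge) (mk_le_mk.1 h2.le)
    (mk_le_mk.1 h2.ge))) (mk_le_mk.2 (hf (mk_le_mk.1 h1.ge) (mk_le_mk.1 h1.le) (mk_le_mk.1 h2.ge)
    (mk_le_mk.1 h2.le)))

namespace Lindenbaum

theorem map₂_and (φ ψ : Form) : map₂ Form.and (mk Γ φ) (mk Γ ψ) = mk Γ (and φ ψ) :=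
  map₂_mk (fun h _ h' _ => imp_and (imp_trans (andLeft _ _) h) (imp_trans (andRight _ _) h')) φ ψ

theorem map₂_or (φ ψ : Form) : map₂ Form.or (mk Γ φ) (mk Γ ψ) = mk Γ (or φ ψ) :=
  map₂_mk (fun h _ h' _ => or_imp (imp_trans h (orLeft _ _)) (imp_trans h' (orRight _ _))) φ ψ

theorem map₂_imp (φ ψ : Form) : map₂ Form.imp (mk Γ φ) (mk Γ ψ) = mk Γ (imp φ ψ) :=
  map₂_mk (fun _ h h' _ => curry (imp_trans (imp_mp (andLeft _ _)
    (imp_trans (andRight _ _) h)) h')) φ ψ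

noncomputable instance : Lattice (Lindenbaum Γ) where
  sup := map₂ or
  inf := map₂ and
  le_sup_left a b := by
    obtain ⟨φ, rfl⟩ := a.exists_mk; obtain ⟨ψ, rfl⟩ := b.exists_mk
    rw [map₂_or]; exact mk_le_mk.2 (orLeft _ _)
  le_sup_right a b := by
    obtain ⟨φ, rfl⟩ := a.exists_mk; obtain ⟨ψ, rfl⟩ := b.exists_mk
    rw [map₂_or]; exact mk_le_mk.2 (orRight _ _)
  sup_le a b c h h' := by
    obtain ⟨φ, rfl⟩ := a.exists_mk; obtain ⟨ψ, rfl⟩ := b.exists_mk; obtain ⟨χ, rfl⟩ := c.exists_mk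
    rw [map₂_or]; exact mk_le_mk.2 (or_imp (mk_le_mk.1 h) (mk_le_mk.1 h'))
  inf_le_left a b := by
    obtain ⟨φ, rfl⟩ := a.exists_mk; obtain ⟨ψ, rfl⟩ := b.exists_mk
    rw [map₂_and]; exact mk_le_mk.2 (andLeft _ _)
  inf_le_right a b := by
    obtain ⟨φ, rfl⟩ := a.exists_mk; obtain ⟨ψ, rfl⟩ := b.exists_mk
    rw [map₂_and]; exact mk_le_mk.2 (andRight _ _)
  le_inf a b c h h' := by
    obtain ⟨φ, rfl⟩ := a.exists_mk; obtain ⟨ψ, rfl⟩ := b.exists_mk; obtain ⟨χ, rfl⟩ := c.exists_mk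
    rw [map₂_and]; exact mk_le_mk.2 (imp_and (mk_le_mk.1 h) (mk_le_mk.1 h'))

theorem mk_and (φ ψ : Form) : mk Γ (and φ ψ) = mk Γ φ ⊓ mk Γ ψ := (map₂_and φ ψ).symm

theorem mk_or (φ ψ : Form) : mk Γ (or φ ψ) = mk Γ φ ⊔ mk Γ ψ := (map₂_or φ ψ).symm

noncomputable instance : HeytingAlgebra (Lindenbaum Γ) where
  top := mk Γ top
  bot := mk Γ bot
  himp := map₂ imp
  compl a := map₂ imp a (mk Γ bot)
  himp_bot _ := rfl
  le_top a := by
    obtain ⟨φ, rfl⟩ := a.exists_mk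
    exact mk_le_mk.2 (weaken (imp_refl bot) φ)
  bot_le a := by
    obtain ⟨φ, rfl⟩ := a.exists_mk
    exact mk_le_mk.2 (exFalso φ)
  le_himp_iff a b c := by
    obtain ⟨φ, rfl⟩ := a.exists_mk; obtain ⟨ψ, rfl⟩ := b.exists_mk; obtain ⟨χ, rfl⟩ := c.exists_mk
    rw [map₂_imp, ← mk_and]
    exact ⟨fun h => mk_le_mk.2 (uncurry (mk_le_mk.1 h)),
      fun h => mk_le_mk.2 (curry (mk_le_mk.1 h))⟩

theorem mk_imp (φ ψ : Form) : mk Γ (imp φ ψ) = mk Γ φ ⇨ mk Γ ψ := (map₂_imp φ ψ).symm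

theorem mk_eq_top_iff : mk Γ φ = ⊤ ↔ Provable Γ φ := by
  rw [← top_le_iff]
  exact ⟨fun h => mp (mk_le_mk.1 h) (imp_refl bot), fun h => mk_le_mk.2 (weaken h _)⟩

/-- Valuations in the Lindenbaum algebra are substitutions, so closure under substitution makes it
an algebra for the logic. -/
theorem eval_eq_mk_subst (σ : ℕ → Form) (φ : Form) :
    φ.eval (fun n => mk Γ (σ n)) = mk Γ (φ.subst σ) := by
  induction φ with
  | var n => rfl
  | bot => rfl
  | and φ ψ ih₁ ih₂ => rw [eval, ih₁, ih₂, ← mk_and]; rfl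
  | or φ ψ ih₁ ih₂ => rw [eval, ih₁, ih₂, ← mk_or]; rfl
  | imp φ ψ ih₁ ih₂ => rw [eval, ih₁, ih₂, ← mk_imp]; rfl

theorem subst_var (φ : Form) : φ.subst var = φ := by
  induction φ with
  | var n => rfl
  | bot => rfl
  | and φ ψ ih₁ ih₂ => rw [Form.subst, ih₁, ih₂]
  | or φ ψ ih₁ ih₂ => rw [Form.subst, ih₁, ih₂]
  | imp φ ψ ih₁ ih₂ => rw [Form.subst, ih₁, ih₂]

theorem eval_var (φ : Form) : φ.eval (fun n => mk Γ (var n)) = mk Γ φ := by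
  rw [eval_eq_mk_subst, subst_var]

theorem isAlgebraFor : IsAlgebraFor (Lindenbaum Γ) (IPCPlus Γ) := by
  intro φ hφ a
  choose σ hσ using fun n => (a n).exists_mk
  rw [← funext hσ, eval_eq_mk_subst, mk_eq_top_iff]
  exact Provable.subst σ hφ

end Lindenbaum

/-! ### From local finiteness to local tabularity -/

theorem generated_eval {H : Type u} [HeytingAlgebra H] {S : Set H} (a : ℕ → H) (φ : Form)
    (h : ∀ n ∈ φ.vars, a n ∈ S) : Generated S (φ.eval a) := by
  induction φ with
  | var n => exact .basic (h n rfl)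
  | bot => exact .bot
  | and φ ψ ih₁ ih₂ =>
    exact .inf (ih₁ fun n hn => h n (Or.inl hn)) (ih₂ fun n hn => h n (Or.inr hn))
  | or φ ψ ih₁ ih₂ =>
    exact .sup (ih₁ fun n hn => h n (Or.inl hn)) (ih₂ fun n hn => h n (Or.inr hn))
  | imp φ ψ ih₁ ih₂ =>
    exact .himp (ih₁ fun n hn => h n (Or.inl hn)) (ih₂ fun n hn => h n (Or.inr hn))

theorem locallyTabular_of_locallyFiniteAlgebra (h : LocallyFiniteAlgebra (Lindenbaum Γ)) :
    LocallyTabular (IPCPlus Γ) := by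
  intro s
  let C : Set (Lindenbaum Γ) := Lindenbaum.mk Γ '' {φ | φ.vars ⊆ s}
  have hC : C.Finite := by
    refine (h ((fun n => Lindenbaum.mk Γ (var n)) '' s) (s.finite_toSet.image _)).subset ?_
    rintro _ ⟨φ, hφ, rfl⟩
    rw [Set.mem_ofPred_eq, ← Lindenbaum.eval_var]
    exact generated_eval _ _ fun n hn => ⟨n, hφ hn, rfl⟩
  have hex : ∀ c ∈ C, ∃ φ : Form, φ.vars ⊆ s ∧ Lindenbaum.mk Γ φ = c := fun c hc => hc
  have : Nonempty Form := ⟨bot⟩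
  choose! f hf hf' using hex
  refine ⟨f '' C, hC.image f, ?_, fun φ hφ => ⟨_, ⟨_, ⟨φ, hφ, rfl⟩, rfl⟩, ?_⟩⟩
  · rintro _ ⟨c, hc, rfl⟩
    exact hf c hc
  · have h := hf' _ (⟨φ, hφ, rfl⟩ : Lindenbaum.mk Γ φ ∈ C)
    exact Provable.mp (Provable.mp (andIntro _ _) (Lindenbaum.mk_le_mk.1 h.ge))
      (Lindenbaum.mk_le_mk.1 h.le)

end Lindenbaum

/-! ### Combs -/

section Combs

namespace Comb

variable {n : ℕ} {i j : Fin n}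

theorem base_le_base : base i ≤ base j ↔ i ≤ j := Iff.rfl

theorem base_le_tooth : base i ≤ tooth j ↔ i ≤ j := Iff.rfl

theorem not_tooth_le_base : ¬ tooth i ≤ base j := id

theorem tooth_le_tooth : tooth i ≤ tooth j ↔ i = j := Iff.rfl

theorem eq_of_tooth_le {c : Comb n} (h : tooth i ≤ c) : c = tooth i := by
  cases c with
  | base j => exact absurd h not_tooth_le_base
  | tooth j => rw [tooth_le_tooth.1 h]

theorem exists_eq_base_of_lt {c d : Comb n} (h : c < d) : ∃ i, c = base i := by
  cases c with
  | base i => exact ⟨i, rfl⟩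
  | tooth i => exact absurd (eq_of_tooth_le h.le) h.ne'

theorem base_zero_le (hn : 0 < n) (c : Comb n) : base ⟨0, hn⟩ ≤ c := by
  cases c <;> exact Nat.zero_le _

theorem base_le_cases {c : Comb n} (h : base i ≤ c) :
    c = base i ∨ c = tooth i ∨ ∃ k : Fin n, (k : ℕ) = i + 1 ∧ base k ≤ c := by
  cases c with
  | base j =>
    rcases (base_le_base.1 h).eq_or_lt with rfl | hij
    · exact Or.inl rfl
    · have := j.2
      have h' : (i : ℕ) < j := hij
      exact Or.inr (Or.inr ⟨⟨i + 1, by omega⟩, rfl, base_le_base.2 h'⟩)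
  | tooth j =>
    rcases (base_le_tooth.1 h).eq_or_lt with rfl | hij
    · exact Or.inr (Or.inl rfl)
    · have := j.2
      have h' : (i : ℕ) < j := hij
      exact Or.inr (Or.inr ⟨⟨i + 1, by omega⟩, rfl, base_le_tooth.2 h'⟩)

instance : Finite (Comb n) :=
  Finite.of_surjective (Sum.elim base tooth : Fin n ⊕ Fin n → Comb n) fun c => by
    cases c with
    | base i => exact ⟨Sum.inl i, rfl⟩
    | tooth i => exact ⟨Sum.inr i, rfl⟩

/-- The Yankov formula of a poset with two incomparable points that are not maximal holds in all
combs. -/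
theorem validates_yankov_of_incomparable {Q : Type v} [PartialOrder Q] [Finite Q]
    {r a b a' b' : Q} (hr : ∀ q, r ≤ q) (hab : ¬ a ≤ b) (hba : ¬ b ≤ a) (ha : a ≤ a')
    (ha' : a ≠ a') (hb : b ≤ b') (hb' : b ≠ b') : Validates (Comb n) (yankov Q r) := by
  by_contra hcon
  obtain ⟨y, g, hg, hy⟩ := exists_isPMorphismAbove hr hcon
  -- A non-maximal point of `Q` lifts to a non-maximal point of the comb, hence to a base point;
  -- base points form a chain.
  have aux : ∀ q q' : Q, q ≤ q' → q ≠ q' → ∃ i, y ≤ base i ∧ g (base i) = q := by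
    intro q q' hq hne
    obtain ⟨w, hw, rfl⟩ := hg.back y le_rfl q (hy ▸ hr q)
    obtain ⟨w', hw', rfl⟩ := hg.back w hw q' hq
    obtain ⟨i, rfl⟩ := exists_eq_base_of_lt (lt_of_le_of_ne hw' fun h => hne (h ▸ rfl))
    exact ⟨i, hw, rfl⟩
  obtain ⟨i, hi, rfl⟩ := aux a a' ha ha'
  obtain ⟨j, hj, rfl⟩ := aux b b' hb hb'
  rcases le_total i j with h | h
  · exact hab (hg.mono _ _ hi h)
  · exact hba (hg.mono _ _ hj h)

end Comb

/-- A point of the three-fork. -/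
def Q8.pt (i : Fin 4) : Q8 := i

theorem Q8.pt_le {i j : Fin 4} : Q8.pt i ≤ Q8.pt j ↔ i = j ∨ i = 0 := Iff.rfl

theorem Q8.pt_injective : Function.Injective Q8.pt := fun _ _ h => h

/-- The last base point over the root has only its tooth and the next base point directly above it,
too few for three maximal values. -/
theorem Comb.validates_yankov_Q8 {n : ℕ} : Validates (Comb n) (yankov Q8 (0 : Fin 4)) := by
  by_contra hcon
  obtain ⟨y, g, hg, hy⟩ := exists_isPMorphismAbove (fun _ => Or.inr rfl) hcon
  replace hy : g y = Q8.pt 0 := hy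
  obtain ⟨w, hw, hgw⟩ := hg.back y le_rfl (Q8.pt 1) (hy ▸ Or.inr rfl)
  obtain ⟨i, rfl⟩ := exists_eq_base_of_lt (lt_of_le_of_ne hw fun h => by
    rw [← h, hy] at hgw
    exact absurd (Q8.pt_injective hgw) (by decide))
  obtain ⟨j, hj⟩ := (Set.toFinite {j : Fin n | base i ≤ base j ∧ g (base j) = Q8.pt 0}).exists_maximal
    ⟨i, le_rfl, hy⟩
  have hpt : ∀ m : Fin 4, m ≠ 0 → g (tooth j) = Q8.pt m ∨
      ∃ k : Fin n, (k : ℕ) = j + 1 ∧ g (base k) = Q8.pt m := by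
    intro m hm
    obtain ⟨w, hw, hgw⟩ := hg.back _ hj.prop.1 (Q8.pt m) (hj.prop.2 ▸ Or.inr rfl)
    rcases base_le_cases hw with rfl | rfl | ⟨k, hk, hkw⟩
    · exact absurd (Q8.pt_injective (hgw.symm.trans hj.prop.2)) hm
    · exact Or.inl hgw
    · refine Or.inr ⟨k, hk, ?_⟩
      have hjk : j < k := Fin.lt_def.2 (by omega)
      have hik : base i ≤ base k := hj.prop.1.trans (base_le_base.2 hjk.le)
      rcases hg.mono _ _ hik hkw with h | h
      · exact h.trans hgw
      -- The next base point cannot go to the root, by the choice of `j`.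
      · exact absurd (hj.le_of_ge ⟨hik, h⟩ hjk.le) hjk.not_ge
  have e : ∀ {a b : Fin 4} {q : Q8}, q = Q8.pt a → q = Q8.pt b → a = b :=
    fun h h' => Q8.pt_injective (h.symm.trans h')
  have e' : ∀ {a b : Fin 4}, (∃ k : Fin n, (k : ℕ) = j + 1 ∧ g (base k) = Q8.pt a) →
      (∃ k : Fin n, (k : ℕ) = j + 1 ∧ g (base k) = Q8.pt b) → a = b := by
    rintro a b ⟨k, hk, ha⟩ ⟨k', hk', hb⟩
    obtain rfl : k = k' := Fin.ext (hk.trans hk'.symm)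
    exact e ha hb
  have d12 : (1 : Fin 4) ≠ 2 := by decide
  have d13 : (1 : Fin 4) ≠ 3 := by decide
  have d23 : (2 : Fin 4) ≠ 3 := by decide
  rcases hpt 1 (by decide) with h1 | h1 <;> rcases hpt 2 (by decide) with h2 | h2 <;>
    rcases hpt 3 (by decide) with h3 | h3
  exacts [d12 (e h1 h2), d12 (e h1 h2), d13 (e h1 h3), d23 (e' h2 h3), d23 (e h2 h3),
    d13 (e' h1 h3), d12 (e' h1 h2), d12 (e' h1 h2)]

/-- In all but the three-fork, the points `1` and `2` are incomparable and non-maximal. -/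
theorem Comb.validates_combAxioms {n : ℕ} {φ : Form} (h : φ ∈ combAxioms) :
    Validates (Comb n) φ := by
  simp only [combAxioms, Set.mem_insert_iff, Set.mem_singleton_iff] at h
  rcases h with rfl | rfl | rfl | rfl | rfl | rfl
  · have h : ∀ i j : Fin 5, @LE.le Q2 _ i j ↔ i = j ∨ i = 0 ∨ (i = 1 ∧ (j = 3 ∨ j = 4)) ∨ (i = 2 ∧ j = 4) :=
      fun _ _ => Iff.rfl
    exact validates_yankov_of_incomparable (fun _ => Or.inr (Or.inl rfl))
      ((h 1 2).not.2 (by decide)) ((h 2 1).not.2 (by decide))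
      ((h 1 4).2 (by decide)) (show (1 : Fin 5) ≠ 4 by decide)
      ((h 2 4).2 (by decide)) (show (2 : Fin 5) ≠ 4 by decide)
  · have h : ∀ i j : Fin 5, @LE.le Q4 _ i j ↔ i = j ∨ i = 0 ∨ ((i = 1 ∨ i = 2) ∧ (j = 3 ∨ j = 4)) :=
      fun _ _ => Iff.rfl
    exact validates_yankov_of_incomparable (fun _ => Or.inr (Or.inl rfl))
      ((h 1 2).not.2 (by decide)) ((h 2 1).not.2 (by decide))
      ((h 1 4).2 (by decide)) (show (1 : Fin 5) ≠ 4 by decide)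
      ((h 2 4).2 (by decide)) (show (2 : Fin 5) ≠ 4 by decide)
  · have h : ∀ i j : Fin 6, @LE.le Q5 _ i j ↔ i = j ∨ i = 0 ∨ j = 5 ∨ ((i = 1 ∨ i = 2) ∧ (j = 3 ∨ j = 4)) :=
      fun _ _ => Iff.rfl
    exact validates_yankov_of_incomparable (fun _ => Or.inr (Or.inl rfl))
      ((h 1 2).not.2 (by decide)) ((h 2 1).not.2 (by decide))
      ((h 1 4).2 (by decide)) (show (1 : Fin 6) ≠ 4 by decide)
      ((h 2 4).2 (by decide)) (show (2 : Fin 6) ≠ 4 by decide)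
  · have h : ∀ i j : Fin 4, @LE.le Q6 _ i j ↔ i = j ∨ i = 0 ∨ j = 3 :=
      fun _ _ => Iff.rfl
    exact validates_yankov_of_incomparable (fun _ => Or.inr (Or.inl rfl))
      ((h 1 2).not.2 (by decide)) ((h 2 1).not.2 (by decide))
      ((h 1 3).2 (by decide)) (show (1 : Fin 4) ≠ 3 by decide)
      ((h 2 3).2 (by decide)) (show (2 : Fin 4) ≠ 3 by decide)
  · have h : ∀ i j : Fin 5, @LE.le Q7 _ i j ↔ i = j ∨ i = 0 ∨ (i = 1 ∧ j = 3) ∨ (i = 2 ∧ j = 4) :=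
      fun _ _ => Iff.rfl
    exact validates_yankov_of_incomparable (fun _ => Or.inr (Or.inl rfl))
      ((h 1 2).not.2 (by decide)) ((h 2 1).not.2 (by decide))
      ((h 1 3).2 (by decide)) (show (1 : Fin 5) ≠ 3 by decide)
      ((h 2 4).2 (by decide)) (show (2 : Fin 5) ≠ 4 by decide)
  · exact validates_yankov_Q8

/-- A broken comb is a p-morphic image of a comb. -/
theorem IsBrokenComb.validates {P : Type u} [PartialOrder P] (hP : IsBrokenComb P) {φ : Form}
    (hφ : φ ∈ LFC) : Validates P φ := by
  classical
  obtain ⟨n, hn, e, he⟩ := hP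
  -- `m` is the last tooth if it is present, otherwise the last base point, which is then maximal in
  -- `P`.
  have hm : ∃ m : P, (∀ q, m ≤ q → q = m) ∧ ∀ j, Comb.base j ≤ e m := by
    let l : Fin n := ⟨n - 1, by omega⟩
    have hl : ∀ j : Fin n, j ≤ l := fun j => Fin.le_def.2 (Nat.le_sub_one_of_lt j.2)
    by_cases h : Comb.tooth l ∈ Set.range e
    · obtain ⟨m, hm⟩ := h
      refine ⟨m, fun q hq => e.injective ?_, fun j => hm ▸ hl j⟩
      rw [hm]
      exact Comb.eq_of_tooth_le (hm ▸ e.le_iff_le.2 hq)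
    · obtain ⟨m, hm⟩ := he l
      refine ⟨m, fun q hq => e.injective ?_, fun j => hm ▸ hl j⟩
      have hq' := e.le_iff_le.2 hq
      rw [hm] at hq' ⊢
      rcases Comb.base_le_cases hq' with h' | h' | ⟨k, hk, -⟩
      · exact h'
      · exact absurd ⟨q, h'⟩ h
      · have := k.2
        have : (l : ℕ) = n - 1 := rfl
        omega
  obtain ⟨m, hmax, hm⟩ := hm
  -- All missing teeth collapse to `m`; since `m` is above every base point, monotonicity survives.
  let g : Comb n → P := Function.extend e id fun _ => m
  have hge : ∀ p, g (e p) = p := fun p => e.injective.extend_apply _ _ p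
  have hgm : ∀ c, c ∉ Set.range e → g c = m := fun c hc => Function.extend_apply' _ _ _ hc
  have hbase : ∀ c, c ∉ Set.range e → ∃ i, c = Comb.tooth i := by
    intro c hc
    cases c with
    | base i => exact absurd (he i) hc
    | tooth i => exact ⟨i, rfl⟩
  have hg : IsPMorphismAbove (Comb.base ⟨0, hn⟩) g := by
    constructor
    · intro z w _ hzw
      by_cases hz : z ∈ Set.range e
      · obtain ⟨p, rfl⟩ := hz
        by_cases hw : w ∈ Set.range e
        · obtain ⟨q, rfl⟩ := hw
          rw [hge, hge]
          exact e.le_iff_le.1 hzw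
        · rw [hge, hgm w hw]
          refine e.le_iff_le.1 ?_
          obtain ⟨i, hi⟩ := Comb.exists_eq_base_of_lt
            (lt_of_le_of_ne hzw fun h => hw ⟨p, h⟩)
          exact hi ▸ hm i
      · obtain ⟨i, rfl⟩ := hbase z hz
        rw [Comb.eq_of_tooth_le hzw]
    · intro z _ q hq
      by_cases hz : z ∈ Set.range e
      · obtain ⟨p, rfl⟩ := hz
        rw [hge] at hq
        exact ⟨e q, e.le_iff_le.2 hq, hge q⟩
      · rw [hgm z hz] at hq
        exact ⟨z, le_rfl, by rw [hgm z hz, hmax q hq]⟩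
  intro V hV x
  rw [← hge x, ← hg.forces_iff V φ (e x) (Comb.base_zero_le hn _)]
  refine hφ n hn _ (fun k a b hab ha => hV k (hg.mono a b (Comb.base_zero_le hn _) hab) ha) _

theorem ipcPlus_subset_LFC : IPCPlus combAxioms ⊆ LFC :=
  fun _ hφ _ _ => Provable.validates (fun _ => Comb.validates_combAxioms) hφ

end Combs

/-! ### Finite rooted frames -/

section Frames

variable {P : Type u} [PartialOrder P]

/-- By finiteness every point lies below a maximal one, which belongs to both upsets. -/
theorem le_or_le_of_not_isMax [Finite P] (h6 : Validates P (yankov Q6 (0 : Fin 4))) {r x y : P}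
    (hr : ∀ p, r ≤ p) (hx : ¬ IsMax x) (hy : ¬ IsMax y) : x ≤ y ∨ y ≤ x := by
  by_contra hcon
  push Not at hcon
  have aux : ∀ x : P, IsUpperSet {z | x ≤ z ∨ IsMax z} := fun x a b hab ha =>
    ha.imp (fun h => h.trans hab) (fun h => h.mono hab)
  refine (diamondMap_isPMorphismAbove (r := r) (aux x) (aux y) fun z _ => ?_).not_validates_yankov
    (diamondMap_eq_zero (hr x) (Or.inl le_rfl) (fun h => h.elim hcon.2 hx) (hr y) (Or.inl le_rfl)
      (fun h => h.elim hcon.1 hy)) h6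
  obtain ⟨m, hm, hmax⟩ := Finite.exists_le_maximal (p := fun _ : P => True) (a := z) trivial
  have hmax' : IsMax m := fun b hb => hmax.le_of_ge trivial hb
  exact ⟨m, hm, Or.inr hmax', Or.inr hmax'⟩

/-- No point of a frame for the Yankov formula of the three-fork is covered by two maximal points
and lies below a third one. -/
theorem not_validates_yankov_Q8 {z p q m : P} (hp : IsMax p) (hq : IsMax q) (hpq : p ≠ q)
    (hmp : m ≠ p) (hmq : m ≠ q) (hzp : z < p) (hzq : z < q) (hzm : z < m)
    (hp' : ∀ w, z < w → w ≤ p → w = p) (hq' : ∀ w, z < w → w ≤ q → w = q) :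
    ¬ Validates P (yankov Q8 (0 : Fin 4)) := by
  classical
  let g : P → Q8 := fun w => Q8.pt (if w = p then 1 else if w = q then 2 else if z < w then 3 else 0)
  have gp : g p = Q8.pt 1 := by simp [g]
  have gq : g q = Q8.pt 2 := by simp [g, hpq.symm]
  have gm : g m = Q8.pt 3 := by simp [g, hmp, hmq, hzm]
  have gz : g z = Q8.pt 0 := by simp [g, hzp.ne, hzq.ne]
  -- Nothing lies strictly between `z` and `p` or `q`, so `g` is constant along the order strictly
  -- above `z`.
  have hg : ∀ a b, z < a → a ≤ b → g a = g b := by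
    intro a b ha hab
    by_cases h1 : b = p
    · subst h1; rw [hp' a ha hab]
    by_cases h2 : b = q
    · subst h2; rw [hq' a ha hab]
    have h3 : a ≠ p := fun h => h1 ((hp.eq_of_le (h ▸ hab)).symm)
    have h4 : a ≠ q := fun h => h2 ((hq.eq_of_le (h ▸ hab)).symm)
    simp [g, h1, h2, h3, h4, ha, ha.trans_le hab]
  refine IsPMorphismAbove.not_validates_yankov (y := z) (g := g) ⟨?_, ?_⟩ gz
  · intro a b ha hab
    rcases ha.eq_or_lt with rfl | ha
    · rw [gz]; exact Or.inr rfl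
    · exact (hg a b ha hab).le
  · intro a ha c hc
    rcases ha.eq_or_lt with rfl | ha
    · obtain ⟨i, hi⟩ : ∃ i, Q8.pt i = c := ⟨c, rfl⟩
      rw [← hi]
      fin_cases i
      exacts [⟨z, le_rfl, gz⟩, ⟨p, hzp.le, gp⟩, ⟨q, hzq.le, gq⟩, ⟨m, hzm.le, gm⟩]
    · refine ⟨a, le_rfl, hc.elim id fun h => ?_⟩
      have h0 : g a = Q8.pt 0 := h
      have h1 : g a ≠ Q8.pt 0 := by
        intro h
        have := Q8.pt_injective h
        split_ifs at this <;> simp_all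
      exact absurd h0 h1

/-- Non-maximal points form a chain, so counting those below a point determines which ones they are;
this count is the coordinate in the comb. -/
theorem isBrokenComb_of_validates [Finite P] (hroot : IsRooted P)
    (h6 : Validates P (yankov Q6 (0 : Fin 4))) (h8 : Validates P (yankov Q8 (0 : Fin 4))) :
    IsBrokenComb P := by
  classical
  obtain ⟨r, hr⟩ := hroot
  have := Fintype.ofFinite P
  have chain : ∀ {x y : P}, ¬ IsMax x → ¬ IsMax y → x ≤ y ∨ y ≤ x :=
    fun hx hy => le_or_le_of_not_isMax h6 hr hx hy
  let N : Finset P := Finset.univ.filter fun q => ¬ IsMax q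
  let F : P → Finset P := fun p => Finset.univ.filter fun q => ¬ IsMax q ∧ q < p
  let c : P → ℕ := fun p => (F p).card
  have mem_F : ∀ {p q : P}, q ∈ F p ↔ ¬ IsMax q ∧ q < p := by simp [F]
  have mem_N : ∀ {q : P}, q ∈ N ↔ ¬ IsMax q := by simp [N]
  have hc_le : ∀ p, c p ≤ N.card := fun p =>
    Finset.card_le_card fun q hq => mem_N.2 (mem_F.1 hq).1
  have lt_iff : ∀ {p q : P}, ¬ IsMax p → (c p < c q ↔ p < q) := by
    intro p q hp
    constructor
    · intro h
      by_contra hpq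
      refine h.not_ge (Finset.card_le_card fun s hs => ?_)
      obtain ⟨hs, hsq⟩ := mem_F.1 hs
      refine mem_F.2 ⟨hs, ?_⟩
      rcases chain hp hs with h' | h'
      · exact absurd (h'.trans_lt hsq) hpq
      · exact lt_of_le_of_ne h' fun h' => hpq (h' ▸ hsq)
    · intro h
      refine Finset.card_lt_card ⟨fun s hs => ?_, fun hsub => ?_⟩
      · exact mem_F.2 ⟨(mem_F.1 hs).1, (mem_F.1 hs).2.trans h⟩
      · exact (mem_F.1 (hsub (mem_F.2 ⟨hp, h⟩))).2.false
  -- A maximal point above the whole chain becomes the last base point; the remaining maximal points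
  -- become teeth.
  obtain ⟨m, hm, hNm⟩ : ∃ m : P, IsMax m ∧ ∀ q, ¬ IsMax q → q < m := by
    by_cases hne : N.Nonempty
    · obtain ⟨t, ht⟩ := N.exists_maximal hne
      obtain ⟨m, htm, hmax⟩ := Finite.exists_le_maximal (p := fun _ : P => True) (a := t) trivial
      have hmax' : IsMax m := fun b hb => hmax.le_of_ge trivial hb
      refine ⟨m, hmax', fun q hq => lt_of_le_of_ne ?_ fun h => hq (h ▸ hmax')⟩
      refine le_trans ?_ htm
      rcases chain hq (mem_N.1 ht.prop) with h | h
      · exact h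
      · exact ht.le_of_ge (mem_N.2 hq) h
    · have hall : ∀ q : P, IsMax q := fun q => by
        by_contra h
        exact hne ⟨q, mem_N.2 h⟩
      exact ⟨r, hall r, fun q hq => absurd (hall q) hq⟩
  have hcm : c m = N.card := le_antisymm (hc_le m)
    (Finset.card_le_card fun q hq => mem_F.2 ⟨mem_N.1 hq, hNm q (mem_N.1 hq)⟩)
  have hroot_lt : ∀ {p : P}, IsMax p → p ≠ m → ¬ IsMax r ∧ r < p := by
    intro p hp hpm
    have hrp : r < p := lt_of_le_of_ne (hr p) fun h => by
      subst h
      exact hpm (hp.eq_of_le (hr m))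
    exact ⟨hrp.not_isMax, hrp⟩
  have hc_pos : ∀ {p : P}, IsMax p → p ≠ m → 0 < c p := fun hp hpm =>
    Finset.card_pos.2 ⟨r, mem_F.2 (hroot_lt hp hpm)⟩
  have hinj : ∀ {p q : P}, IsMax p → IsMax q → p ≠ m → q ≠ m → c p = c q → p = q := by
    intro p q hp hq hpm hqm hpq
    by_contra hne
    -- Equal counts put `p` and `q` above the same non-maximal points; at the greatest of these,
    -- `p`, `q` and `m` would form a three-fork.
    obtain ⟨z, hz⟩ := (F p).exists_maximal ⟨r, mem_F.2 (hroot_lt hp hpm)⟩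
    obtain ⟨hz', hzp⟩ := mem_F.1 hz.prop
    have aux : ∀ w, z < w → ¬ w < p := fun w hzw hwp =>
      (hz.le_of_ge (mem_F.2 ⟨hwp.not_isMax, hwp⟩) hzw.le).not_gt hzw
    have hlt : ∀ {w}, ¬ IsMax w → (w < p ↔ w < q) := fun hw => by
      rw [← lt_iff hw, ← lt_iff hw, hpq]
    refine not_validates_yankov_Q8 hp hq hne hpm.symm hqm.symm hzp ((hlt hz').1 hzp) (hNm z hz')
      (fun w hzw hwp => ?_) (fun w hzw hwq => ?_) h8
    · by_contra h
      exact aux w hzw (lt_of_le_of_ne hwp h)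
    · by_contra h
      have h' := lt_of_le_of_ne hwq h
      exact aux w hzw ((hlt h'.not_isMax).2 h')
  have base_iff : ∀ {p q : P}, (¬ IsMax p ∨ p = m) → (¬ IsMax q ∨ q = m) →
      (c p ≤ c q ↔ p ≤ q) := by
    intro p q hp hq
    constructor
    · intro h
      by_contra hpq
      have hqp : q < p := by
        rcases hp with hp | rfl <;> rcases hq with hq | rfl
        · exact lt_of_le_not_ge ((chain hp hq).resolve_left hpq) hpq
        · exact absurd (hNm p hp).le hpq
        · exact hNm q hq
        · exact absurd le_rfl hpq
      exact h.not_gt ((lt_iff hqp.not_isMax).2 hqp)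
    · intro h
      rcases h.eq_or_lt with rfl | h
      · exact le_rfl
      · exact ((lt_iff h.not_isMax).2 h).le
  -- The base has `N.card + 1` points, namely `N` and `m`. The tooth of index `i` has `i + 1` base
  -- points below it, hence `c p - 1`, where `c p` is positive by `hc_pos`.
  let e : P → Comb (N.card + 1) := fun p =>
    if ¬ IsMax p ∨ p = m then Comb.base ⟨c p, Nat.lt_succ_of_le (hc_le p)⟩
    else Comb.tooth ⟨c p - 1, Nat.lt_succ_of_le ((Nat.sub_le _ _).trans (hc_le p))⟩
  have he : ∀ p q, e p ≤ e q ↔ p ≤ q := by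
    intro p q
    by_cases hp : ¬ IsMax p ∨ p = m <;> by_cases hq : ¬ IsMax q ∨ q = m
    · simp only [e, if_pos hp, if_pos hq, Comb.base_le_base, Fin.mk_le_mk]
      exact base_iff hp hq
    · simp only [e, if_pos hp, if_neg hq, Comb.base_le_tooth, Fin.mk_le_mk]
      rw [not_or, not_not] at hq
      have h1 := hc_pos hq.1 hq.2
      rcases hp with hp | rfl
      · have h2 : c p ≤ c q - 1 ↔ c p < c q := by omega
        rw [h2, lt_iff hp]
        exact ⟨le_of_lt, fun h => lt_of_le_of_ne h fun h => hp (h ▸ hq.1)⟩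
      · have h2 := hc_le q
        exact iff_of_false (by omega) fun h => hq.2 (hm.eq_of_le h).symm
    · simp only [e, if_neg hp, if_pos hq]
      refine iff_of_false Comb.not_tooth_le_base fun h => hp ?_
      rw [not_or, not_not] at hp
      rwa [hp.1.eq_of_le h]
    · simp only [e, if_neg hp, if_neg hq, Comb.tooth_le_tooth, Fin.mk.injEq]
      rw [not_or, not_not] at hp hq
      have h1 := hc_pos hp.1 hp.2
      have h2 := hc_pos hq.1 hq.2
      refine ⟨fun h => (hinj hp.1 hq.1 hp.2 hq.2 (by omega)).le, fun h => ?_⟩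
      rw [hp.1.eq_of_le h]
  refine ⟨N.card + 1, Nat.succ_pos _, OrderEmbedding.ofMapLEIff e he, fun i => ?_⟩
  -- The count is injective on `N` with `m` added, so by cardinality every base position is taken.
  have himage : (insert m N).image c = Finset.range (N.card + 1) := by
    refine Finset.eq_of_subset_of_card_le (fun k hk => ?_) ?_
    · obtain ⟨p, -, rfl⟩ := Finset.mem_image.1 hk
      exact Finset.mem_range.2 (Nat.lt_succ_of_le (hc_le p))
    · have hmem : ∀ {p}, p ∈ insert m N → ¬ IsMax p ∨ p = m := fun hp =>
        (Finset.mem_insert.1 hp).symm.imp_left mem_N.1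
      rw [Finset.card_range, Finset.card_image_of_injOn, Finset.card_insert_of_notMem]
      · exact fun h => mem_N.1 h hm
      · exact fun p hp q hq h => le_antisymm ((base_iff (hmem hp) (hmem hq)).1 h.le)
          ((base_iff (hmem hq) (hmem hp)).1 h.ge)
  obtain ⟨p, hp, hpi⟩ := Finset.mem_image.1 (himage ▸ Finset.mem_range.2 i.2)
  refine ⟨p, ?_⟩
  have hp' : ¬ IsMax p ∨ p = m := (Finset.mem_insert.1 hp).symm.imp_left mem_N.1
  simp only [OrderEmbedding.coe_ofMapLEIff, e, if_pos hp', hpi]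

theorem IsBrokenComb.finite (hP : IsBrokenComb P) : Finite P := by
  obtain ⟨n, -, e, -⟩ := hP
  exact Finite.of_injective e e.injective

theorem IsBrokenComb.isRooted (hP : IsBrokenComb P) : IsRooted P := by
  obtain ⟨n, hn, e, he⟩ := hP
  obtain ⟨r, hr⟩ := he ⟨0, hn⟩
  exact ⟨r, fun x => e.le_iff_le.1 (hr ▸ Comb.base_zero_le hn _)⟩

theorem finite_rooted_frame_iff_isBrokenComb :
    (Finite P ∧ IsRooted P ∧ IsFrameFor P (IPCPlus combAxioms)) ↔ IsBrokenComb P :=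
  ⟨fun ⟨_, hr, h⟩ => isBrokenComb_of_validates hr (h _ (.ax yankov_Q6_mem))
    (h _ (.ax yankov_Q8_mem)), fun h => ⟨h.finite, h.isRooted, fun _ hφ =>
      h.validates (ipcPlus_subset_LFC hφ)⟩⟩

end Frames

/-! ### Completeness -/

section Completeness

theorem validates_Ici {X : Type u} [PartialOrder X] {φ : Form} (h : Validates X φ) (x : X) :
    Validates (Set.Ici x) φ := by
  intro V hV y
  have hg : IsPMorphismAbove y (Subtype.val : Set.Ici x → X) :=
    ⟨fun _ _ _ h => h, fun z _ q hq => ⟨⟨q, le_trans z.2 hq⟩, hq, rfl⟩⟩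
  have := (hg.forces_iff (fun n => Subtype.val '' V n) φ y le_rfl).2 (h _ ?_ _)
  · simpa only [Set.preimage_image_eq _ Subtype.val_injective] using this
  · rintro n a b hab ⟨c, hc, rfl⟩
    exact ⟨⟨b, le_trans c.2 hab⟩, hV n hab hc, rfl⟩

/-! ### Finite algebras and generated subalgebras -/

section Algebra

variable {H : Type u} [HeytingAlgebra H]

instance [Finite H] : Finite (PrimeFilter H) :=
  Finite.of_injective PrimeFilter.carrier fun _ _ => PrimeFilter.ext

/-- In a finite algebra a prime filter is generated by the meet of its elements; the join of these
meets over `V` defines `V`. -/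
theorem PrimeFilter.exists_eq_of_isUpperSet [Finite H] {V : Set (PrimeFilter H)}
    (hV : IsUpperSet V) : ∃ a : H, V = {y | a ∈ y} := by
  classical
  have := Fintype.ofFinite H
  have := Fintype.ofFinite (PrimeFilter H)
  let b : PrimeFilter H → H := fun x => (Finset.univ.filter (· ∈ x)).inf id
  have hb : ∀ x y : PrimeFilter H, b x ∈ y ↔ x ≤ y := by
    intro x y
    constructor
    · intro h a ha
      exact mem_of_le (Finset.inf_le (f := id) (Finset.mem_filter.2 ⟨Finset.mem_univ a, ha⟩)) h
    · intro h
      refine h (Finset.inf_induction (p := (· ∈ x)) x.top_mem (fun _ h _ h' => x.inf_mem h h') ?_)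
      intro a ha
      simpa using ha
  refine ⟨(Finset.univ.filter (· ∈ V)).sup b, Set.ext fun y => ⟨fun hy => ?_, fun hy => ?_⟩⟩
  · exact mem_of_le (Finset.le_sup (f := b) (by simpa using hy)) ((hb y y).2 le_rfl)
  · have : ∀ s : Finset (PrimeFilter H), s.sup b ∈ y → ∃ x ∈ s, b x ∈ y := by
      intro s
      induction s using Finset.induction_on with
      | empty => exact fun h => absurd h y.bot_notMem
      | insert x s _ ih =>
        rw [Finset.sup_insert, mem_sup_iff]
        rintro (h | h)
        · exact ⟨x, Finset.mem_insert_self _ _, h⟩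
        · obtain ⟨z, hz, hz'⟩ := ih h
          exact ⟨z, Finset.mem_insert_of_mem hz, hz'⟩
    obtain ⟨x, hx, hxy⟩ := this _ hy
    exact hV ((hb x y).1 hxy) (by simpa using hx)

theorem PrimeFilter.validates [Finite H] {φ : Form} (h : ∀ a : ℕ → H, φ.eval a = ⊤) :
    Validates (PrimeFilter H) φ := by
  intro V hV x
  choose a ha using fun n => exists_eq_of_isUpperSet (hV n)
  rw [funext ha, forces_iff, h]
  exact x.top_mem

/-- A formula of `LFC` holds in all finite algebras that validate the comb axioms. -/
theorem eval_eq_top_of_mem_LFC [Finite H] (hH : IsAlgebraFor H (IPCPlus combAxioms)) {φ : Form}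
    (hφ : φ ∈ LFC) (a : ℕ → H) : φ.eval a = ⊤ := by
  refine PrimeFilter.eq_of_forall_mem_iff fun x => iff_of_true ?_ x.top_mem
  -- The cone of `x` is a finite rooted frame for the logic, and its inclusion into the whole space
  -- is a p-morphism.
  have hx : IsBrokenComb (Set.Ici x) := finite_rooted_frame_iff_isBrokenComb.1
    ⟨inferInstance, ⟨⟨x, Set.mem_Ici.2 le_rfl⟩, fun y => y.2⟩,
      fun ψ hψ => validates_Ici (PrimeFilter.validates (hH ψ hψ)) x⟩
  have hg : IsPMorphismAbove (⟨x, Set.mem_Ici.2 le_rfl⟩ : Set.Ici x)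
      (Subtype.val : Set.Ici x → PrimeFilter H) :=
    ⟨fun _ _ _ h => h, fun z _ q hq => ⟨⟨q, le_trans z.2 hq⟩, hq, rfl⟩⟩
  rw [← PrimeFilter.forces_iff]
  refine (hg.forces_iff _ φ _ le_rfl).1 (hx.validates hφ _ ?_ _)
  exact fun n y z hyz hy => hyz hy

variable (S : Set H)

/-- The subalgebra generated by a set. -/
abbrev GeneratedSubalgebra : Type u := {a : H // Generated S a}

noncomputable instance : HeytingAlgebra (GeneratedSubalgebra S) :=
  letI : Max (GeneratedSubalgebra S) := ⟨fun a b => ⟨a.1 ⊔ b.1, a.2.sup b.2⟩⟩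
  letI : Min (GeneratedSubalgebra S) := ⟨fun a b => ⟨a.1 ⊓ b.1, a.2.inf b.2⟩⟩
  letI : HImp (GeneratedSubalgebra S) := ⟨fun a b => ⟨a.1 ⇨ b.1, a.2.himp b.2⟩⟩
  letI : Bot (GeneratedSubalgebra S) := ⟨⟨⊥, .bot⟩⟩
  letI : Top (GeneratedSubalgebra S) := ⟨⟨⊤, himp_self (a := (⊥ : H)) ▸ .himp .bot .bot⟩⟩
  letI : Compl (GeneratedSubalgebra S) := ⟨fun a => ⟨a.1ᶜ, himp_bot a.1 ▸ a.2.himp .bot⟩⟩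
  Function.Injective.heytingAlgebra Subtype.val Subtype.val_injective Iff.rfl Iff.rfl
    (fun _ _ => rfl) (fun _ _ => rfl) rfl rfl (fun _ => rfl) (fun _ _ => rfl)

variable {S}

theorem GeneratedSubalgebra.val_eval (a : ℕ → GeneratedSubalgebra S) (φ : Form) :
    (φ.eval a).1 = φ.eval fun n => (a n).1 := by
  induction φ with
  | var n => rfl
  | bot => rfl
  | and φ ψ ih₁ ih₂ => rw [eval, eval, ← ih₁, ← ih₂]; rfl
  | or φ ψ ih₁ ih₂ => rw [eval, eval, ← ih₁, ← ih₂]; rfl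
  | imp φ ψ ih₁ ih₂ => rw [eval, eval, ← ih₁, ← ih₂]; rfl

theorem IsAlgebraFor.generatedSubalgebra {L : Set Form} (h : IsAlgebraFor H L) :
    IsAlgebraFor (GeneratedSubalgebra S) L := fun φ hφ a =>
  Subtype.ext ((GeneratedSubalgebra.val_eval a φ).trans (h φ hφ _))

theorem eval_congr {a b : ℕ → H} (φ : Form) (h : ∀ n ∈ φ.vars, a n = b n) :
    φ.eval a = φ.eval b := by
  induction φ with
  | var n => exact h n rfl
  | bot => rfl
  | and φ ψ ih₁ ih₂ =>
    rw [eval, eval, ih₁ fun n hn => h n (Or.inl hn), ih₂ fun n hn => h n (Or.inr hn)]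
  | or φ ψ ih₁ ih₂ =>
    rw [eval, eval, ih₁ fun n hn => h n (Or.inl hn), ih₂ fun n hn => h n (Or.inr hn)]
  | imp φ ψ ih₁ ih₂ =>
    rw [eval, eval, ih₁ fun n hn => h n (Or.inl hn), ih₂ fun n hn => h n (Or.inr hn)]

end Algebra

theorem finite_vars (φ : Form) : φ.vars.Finite := by
  induction φ with
  | var n => exact Set.finite_singleton n
  | bot => exact Set.finite_empty
  | and φ ψ ih₁ ih₂ => exact ih₁.union ih₂
  | or φ ψ ih₁ ih₂ => exact ih₁.union ih₂
  | imp φ ψ ih₁ ih₂ => exact ih₁.union ih₂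

theorem locallyFiniteAlgebra_of_isAlgebraFor {H : Type u} [HeytingAlgebra H]
    (hH : IsAlgebraFor H (IPCPlus combAxioms)) : LocallyFiniteAlgebra H :=
  locallyFiniteAlgebra_of_yankov_Q6 (hH _ (.ax yankov_Q6_mem))

theorem LFC_subset_ipcPlus : LFC ⊆ IPCPlus combAxioms := by
  classical
  intro φ hφ
  let S : Set (Lindenbaum combAxioms) := (fun n => Lindenbaum.mk combAxioms (var n)) '' φ.vars
  have hfin : Finite (GeneratedSubalgebra S) :=
    locallyFiniteAlgebra_of_isAlgebraFor Lindenbaum.isAlgebraFor S ((finite_vars φ).image _)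
  -- Variables outside the formula get the dummy value `⊥`, since their own classes need not lie in
  -- the subalgebra.
  let a : ℕ → GeneratedSubalgebra S := fun n =>
    if hn : n ∈ φ.vars then ⟨Lindenbaum.mk combAxioms (var n), .basic ⟨n, hn, rfl⟩⟩ else ⊥
  have h1 := eval_eq_top_of_mem_LFC Lindenbaum.isAlgebraFor.generatedSubalgebra hφ a
  have h2 : φ.eval (fun n => (a n).1) = Lindenbaum.mk combAxioms φ := by
    rw [← Lindenbaum.eval_var]
    exact eval_congr φ fun n hn => by simp only [a, dif_pos hn]
  refine Lindenbaum.mk_eq_top_iff.1 ?_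
  rw [← h2, ← GeneratedSubalgebra.val_eval, h1]
  rfl

end Completeness

end CombLogic

theorem mainTheorem9 :
    CombLogic.LocallyTabular (CombLogic.IPCPlus CombLogic.combAxioms) ∧
    (∀ (H : Type u) [HeytingAlgebra H],
      CombLogic.IsAlgebraFor H (CombLogic.IPCPlus CombLogic.combAxioms) →
        CombLogic.LocallyFiniteAlgebra H) ∧
    (∀ (P : Type v) [PartialOrder P],
      (Finite P ∧ CombLogic.IsRooted P ∧
        CombLogic.IsFrameFor P (CombLogic.IPCPlus CombLogic.combAxioms)) ↔
      CombLogic.IsBrokenComb P) ∧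
    CombLogic.IPCPlus CombLogic.combAxioms = CombLogic.LFC :=
  ⟨CombLogic.locallyTabular_of_locallyFiniteAlgebra
      (CombLogic.locallyFiniteAlgebra_of_isAlgebraFor CombLogic.Lindenbaum.isAlgebraFor),
    fun _ _ h => CombLogic.locallyFiniteAlgebra_of_isAlgebraFor h,
    fun _ _ => CombLogic.finite_rooted_frame_iff_isBrokenComb,
    CombLogic.ipcPlus_subset_LFC.antisymm CombLogic.LFC_subset_ipcPlus⟩
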